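/- Let $n\ge 1$ and let $P$ be a set of $n$ red and $n$ blue points that are the vertices of a convex polygon $\mathcal P$, labelled $v_0,\dots,v_{2n-1}$ counterclockwise; points are identified with their indices, which are taken modulo $2n$, and $\{i,\dots,j\}$ denotes the cyclic interval $i,i+1,\dots,j$. A set of points is balanced if it contains as many red as blue points. A matching of a set of points is a perfect matching of it by pairwise non-crossing (disjoint) straight segments, each joining a red and a blue point; its value is the length of its longest segment. A pair $(i,j)$ is feasible if some matching of $P$ contains it. Let $o(i)$ be the first point after $i$ in the positive direction such that $(i,o(i))$ is feasible, and $o^{-1}(i)$ the first point from $i$ in the negative direction such that $(o^{-1}(i),i)$ is feasible; $o$ is a bijection with inverse $o^{-1}$, and $\mathcal O(i)=\{o^k(i):k\in\mathbb Z\}$ is the orbit of $i$. A feasible pair $(i,j)$ is an edge if $j=o(i)$ or $i=o(j)$, and a diagonal otherwise. Cutting $\mathcal P$ along the diagonals of a matching $M$ gives regions; a region is $k$-bounded if exactly $k$ diagonals of $M$ bound it, and a cascade of $M$ is a maximal family of diagonals of $M$ connected by $2$-bounded regions. For balanced $\{i,\dots,j\}$, a solution of $\textsc{Matching}^1(i,j)$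 is a matching of minimum value among the matchings of $\{i,\dots,j\}$ that have at most one cascade and for which the segment $v_iv_j$ belongs to a region bounded by at most one diagonal of the matching different from $(i,j)$. The oriented pair $(i,j)$ is necessary if $\{i,\dots,j\}$ is balanced and every solution of $\textsc{Matching}^1(i,j)$ contains the pair. The turning angle $\tau(i,j)\in[0,2\pi)$ is the angle by which $\overrightarrow{v_iv_{i+1}}$ has to be rotated in the positive direction to align with $\overrightarrow{v_{j-1}v_j}$. An oriented pair $(i,j)$ is a candidate pair if it is necessary and $\tau(i,j)\le 2\pi/3$; it is a candidate diagonal if it is moreover a diagonal. For an oriented pair $(i,j)$ let $h$ be the circular arc on the right side of the directed line $v_iv_j$ from which the segment $v_iv_j$ subtends the angle $\pi/3$, let $A$ be its midpoint, let $a^-$ be the arc from $A$ to $v_i$ with centre $v_j$ and $a^+$ the arc from $A$ to $v_j$ with centre $v_i$, and let $\Pi^-$ be the closed region bounded by $h$ and $a^-$, and $\Pi^+$ the closed region bounded by $h$ and $a^+$. A candidate diagonal $(i,j)$ has negative polarity, with pole $i$, if all points of $\{i,\dots,j\}\cap\mathcal O(i)$ other than $i,j$ lie in $\Pi^-$; it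 has positive polarity, with pole $j$, if all these points lie in $\Pi^+$. Then: 1. No two different candidate diagonals of the same polarity have the same point as a pole. 2. The number of candidate pairs (candidate diagonals, with or without a polarity, and candidate edges, all counted as oriented pairs) is at most $3\cdot|P|=6n$. In particular there are $O(n)$ candidate pairs. -/

import Mathlib

/-- `n` red and `n` blue points in convex position in the plane (identified with `ℂ`), labelled
`v 0, …, v (2n-1)` in counterclockwise order; labels are taken modulo `2n`. The points whose label
is in `red` are red, all others are blue. -/
structure BicoloredPolygon (n : ℕ) where
  v : ZMod (2 * n) → ℂ
  red : Set (ZMod (2 * n))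
  inj : Function.Injective v
  /-- If `i, j, k` are pairwise distinct and `j` comes before `k` when one walks from `i` in the
  positive direction, then the triangle `v i, v j, v k` is positively oriented. -/
  ccw : ∀ i j k : ZMod (2 * n), j ≠ i → (j - i).val < (k - i).val →
    0 < (v j - v i).re * (v k - v i).im - (v j - v i).im * (v k - v i).re
  card_red : red.ncard = n
  card_blue : redᶜ.ncard = n

namespace BicoloredPolygon

noncomputable section

variable {n : ℕ} (P : BicoloredPolygon n)

/-- The cyclic interval `{i, i+1, …, j}`. -/
def arc (i j : ZMod (2 * n)) : Set (ZMod (2 * n)) :=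
  {k | (k - i).val ≤ (j - i).val}

/-- A set of points is balanced if it has as many red as blue points. -/
def Balanced (S : Set (ZMod (2 * n))) : Prop :=
  (S ∩ P.red).ncard = (S \ P.red).ncard

/-- The straight line segment joining the two points of an unordered pair. -/
def seg (e : Sym2 (ZMod (2 * n))) : Set ℂ :=
  convexHull ℝ (P.v '' {x | x ∈ e})

/-- The length of the segment joining the two points of an unordered pair. -/
def len (e : Sym2 (ZMod (2 * n))) : NNReal :=
  Sym2.lift ⟨fun a b => nndist (P.v a) (P.v b), fun a b => nndist_comm (P.v a) (P.v b)⟩ e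

/-- `M` is a (perfect, crossing-free, red-blue) matching of the set of points `S`. -/
structure IsMatching (S : Set (ZMod (2 * n))) (M : Finset (Sym2 (ZMod (2 * n)))) : Prop where
  mem_of_mem : ∀ e ∈ M, ∀ x ∈ e, x ∈ S
  bichromatic : ∀ a b, s(a, b) ∈ M → (a ∈ P.red ↔ b ∉ P.red)
  perfect : ∀ x ∈ S, ∃! e, e ∈ M ∧ x ∈ e
  noncrossing : ∀ e ∈ M, ∀ f ∈ M, e ≠ f → Disjoint (P.seg e) (P.seg f)

/-- The value `bn(M)`: the length of a longest segment of `M`. -/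
def bn (M : Finset (Sym2 (ZMod (2 * n)))) : NNReal :=
  M.sup P.len

/-- `(i, j)` is feasible if some matching of the whole point set contains it. -/
def Feasible (i j : ZMod (2 * n)) : Prop :=
  ∃ M, P.IsMatching Set.univ M ∧ s(i, j) ∈ M

/-- `o(i)`: the first point from `i` in the positive direction such that `(i, o(i))` is
feasible. -/
def o (i : ZMod (2 * n)) : ZMod (2 * n) :=
  i + ((sInf {d : ℕ | P.Feasible i (i + (d : ZMod (2 * n)))} : ℕ) : ZMod (2 * n))

/-- `o⁻¹(i)`: the first point from `i` in the negative direction such that `(o⁻¹(i), i)` is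
feasible. -/
def oInv (i : ZMod (2 * n)) : ZMod (2 * n) :=
  i - ((sInf {d : ℕ | P.Feasible (i - (d : ZMod (2 * n))) i} : ℕ) : ZMod (2 * n))

/-- The orbit of `i`: all points `o^k(i)` with `k` an integer. -/
def orbit (i : ZMod (2 * n)) : Set (ZMod (2 * n)) :=
  {j | ∃ k : ℕ, P.o^[k] i = j ∨ P.oInv^[k] i = j}

/-- An edge is a feasible pair with `i = o(j)` or `j = o(i)`. -/
def IsEdge (i j : ZMod (2 * n)) : Prop :=
  P.Feasible i j ∧ (i = P.o j ∨ j = P.o i)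

/-- A diagonal is a feasible pair that is not an edge. -/
def IsDiagonal (i j : ZMod (2 * n)) : Prop :=
  P.Feasible i j ∧ ¬ P.IsEdge i j

/-- The diagonals of `M`. -/
def diagonals (M : Finset (Sym2 (ZMod (2 * n)))) : Set (Sym2 (ZMod (2 * n))) :=
  {e | e ∈ M ∧ ∃ a b, e = s(a, b) ∧ P.IsDiagonal a b}

/-- The chord `e = {a, b}` separates the chords `c` and `d`: one lies on the closed side of `e` that
carries the points `{a, …, b}`, the other on the side that carries `{b, …, a}`. -/
def Separates (e c d : Sym2 (ZMod (2 * n))) : Prop :=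
  ∃ a b, e = s(a, b) ∧ (∀ x ∈ c, x ∈ arc a b) ∧ (∀ x ∈ d, x ∈ arc b a)

/-- Cut the polygon along all diagonals of `M`. For a chord `c` that crosses no diagonal of `M`, this
is the set of the diagonals of `M` that bound, together with `c`, a common region: those that no
diagonal of `M` other than the two separates from `c`.

Since the diagonals of a matching have no common endpoints, every region has a side
`{k, k+1}` of the polygon on its boundary, and each such side is on the boundary of exactly one
region. So the regions are obtained for `c = {k, k+1}`, and `bounding M s(k, k+1)` is then the set
of all diagonals that bound the region at that side. -/
def bounding (M : Finset (Sym2 (ZMod (2 * n)))) (c : Sym2 (ZMod (2 * n))) :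
    Set (Sym2 (ZMod (2 * n))) :=
  {e | e ∈ P.diagonals M ∧ ∀ f ∈ P.diagonals M, f ≠ e → f ≠ c → ¬ Separates f e c}

/-- `e` and `f` are the two diagonals that bound a `2`-bounded region. -/
def Linked (M : Finset (Sym2 (ZMod (2 * n)))) (e f : Sym2 (ZMod (2 * n))) : Prop :=
  e ≠ f ∧ ∃ k : ZMod (2 * n), P.bounding M s(k, k + 1) = {e, f}

/-- The cascades of `M`: the classes of diagonals that are connected by `2`-bounded regions. -/
def cascades (M : Finset (Sym2 (ZMod (2 * n)))) : Set (Set (Sym2 (ZMod (2 * n)))) :=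
  {C | ∃ e ∈ P.diagonals M, C = {f | Relation.ReflTransGen (P.Linked M) e f}}

/-- The admissible matchings of the problem `Matching¹(i, j)`: matchings of `{i, …, j}` with at most
one cascade, such that the segment `(i, j)` belongs to a region bounded by at most one diagonal
different from `(i, j)`. (If `(i, j)` is itself a diagonal of the matching, the region meant is the
one on the side of `{i, …, j}`; no diagonal other than `(i, j)` bounds the region on the other
side.) -/
structure Admissible (i j : ZMod (2 * n)) (M : Finset (Sym2 (ZMod (2 * n)))) : Prop where
  isMatching : P.IsMatching (arc i j) M
  oneCascade : (P.cascades M).Subsingleton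
  region : (P.bounding M s(i, j) \ {s(i, j)}).Subsingleton

/-- A solution of `Matching¹(i, j)`: an admissible matching of minimum value. -/
def IsSolution (i j : ZMod (2 * n)) (M : Finset (Sym2 (ZMod (2 * n)))) : Prop :=
  P.Admissible i j M ∧ ∀ M', P.Admissible i j M' → P.bn M ≤ P.bn M'

/-- The oriented pair `(i, j)` is necessary: `{i, …, j}` is balanced, so that `Matching¹(i, j)` is
defined, and `(i, j)` is contained in all of its solutions. -/
def Necessary (i j : ZMod (2 * n)) : Prop :=
  P.Balanced (arc i j) ∧ ∀ M, P.IsSolution i j M → s(i, j) ∈ M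

/-- The turning angle of `{i, …, j}`: the angle in `[0, 2π)` by which the vector from `v i` to
`v (i+1)` has to be rotated in the positive direction to align with the vector from `v (j-1)` to
`v j`. -/
def turningAngle (i j : ZMod (2 * n)) : ℝ :=
  toIcoMod Real.two_pi_pos 0 (Complex.arg ((P.v j - P.v (j - 1)) / (P.v (i + 1) - P.v i)))

def IsCandidate (i j : ZMod (2 * n)) : Prop :=
  P.Necessary i j ∧ P.turningAngle i j ≤ 2 * Real.pi / 3

def IsCandidateDiagonal (i j : ZMod (2 * n)) : Prop :=
  P.IsCandidate i j ∧ P.IsDiagonal i j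

/-- The point `A` to the right of the directed line `pq` such that `p, A, q` form an equilateral
triangle. -/
def apex (p q : ℂ) : ℂ :=
  p + (q - p) * Complex.exp (-(Real.pi / 3 : ℝ) * Complex.I)

/-- The closed region on the right side of the directed line `pq` between the segment `pq` and the
arc `h` from which `pq` subtends the angle `π/3`; `h` is an arc of the circle through `p`, `q` and
the apex, whose centre is the centroid of these three points. -/
def underArc (p q : ℂ) : Set ℂ :=
  {z | (q - p).re * (z - p).im - (q - p).im * (z - p).re ≤ 0 ∧
    dist z ((p + q + apex p q) / 3) ≤ dist p ((p + q + apex p q) / 3)}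

/-- `Π⁻`, bounded by `h` and the arc between the apex and `p` with centre `q`. -/
def regionNeg (p q : ℂ) : Set ℂ :=
  {z | z ∈ underArc p q ∧ dist p q ≤ dist z q}

/-- `Π⁺`, bounded by `h` and the arc between the apex and `q` with centre `p`. -/
def regionPos (p q : ℂ) : Set ℂ :=
  {z | z ∈ underArc p q ∧ dist p q ≤ dist z p}

inductive Polarity
  | neg
  | pos

/-- The region `Π⁻(p, q)` or `Π⁺(p, q)`. -/
def Polarity.region : Polarity → ℂ → ℂ → Set ℂ
  | .neg => regionNeg
  | .pos => regionPos

/-- The pole of a candidate diagonal `(i, j)`: `i` for negative, `j` for positive polarity. -/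
def Polarity.pole : Polarity → ZMod (2 * n) → ZMod (2 * n) → ZMod (2 * n)
  | .neg, i, _ => i
  | .pos, _, j => j

/-- `(i, j)` is a candidate diagonal of polarity `s`: all points of `{i, …, j}` in the orbit of `i`,
other than `i` and `j`, lie in the region that belongs to `s`. -/
def HasPolarity (s : Polarity) (i j : ZMod (2 * n)) : Prop :=
  P.IsCandidateDiagonal i j ∧
    ∀ k ∈ arc i j ∩ P.orbit i, k ≠ i → k ≠ j → P.v k ∈ s.region (P.v i) (P.v j)

end

end BicoloredPolygon

/-!
Walk around the polygon, one step up at a red point and one step down at a blue point. A segment of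
a crossing-free matching joins an up-step and a down-step between the same two heights (of the same
*level*), because the points on either side of it are balanced. Conversely consecutive points of a
level form a feasible pair. So the orbits are the levels, `o` maps a point to the next point of its
level (`o_add_eq_of_next`), and pairs of consecutive points of a level are edges.

Pairs `(i, o i)` contribute at most `2n` to the number of candidate pairs. For any other candidate
pair `(i, j)`, all points between `i` and `j` on the level of `i` are seen from `i`, or all are seen
from `j`, at an angle of at least `π/3` from the chord `ij`
(`IsCandidate.isWide`). Two such pairs cannot have the angle property at the same
left end `i`: the two angles at `i` add up to `2π/3`, which is more than the turning angle leaves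
room for. The same holds at a right end. Hence there are at most `2n` pairs of each of the two
kinds. A candidate diagonal with a polarity has the angle property at its pole, since in a triangle
the longer side is opposite to the larger angle, and so the pole determines the diagonal.

The angle property comes from necessity. Let a solution `f` contain `(i, j)`, and measure the
directions of all chords from the first edge of the chain `i, …, j`; they lie in `[0, 2π/3]`. In a
triangle of the chain the exterior angle at the middle vertex is at most `2π/3`, which gives
comparisons of lengths (`ConvexChain.dist_le_of_left`, `ConvexChain.dist_le_of_right`). If some
chord from `i` makes an angle of more than `π/3` with `ij`, then the points with this property form
an initial part of the chain, only chords from this part to the rest can be longer than `ij`, and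
those grow when their right end moves on. Let `C` be the cut behind the initial part. A purely
combinatorial construction (`exists_straightened`) turns `f` into a matching whose pairs are
consecutive in their level, except for pairs across `C`, which are obtained from pairs of `f` by
moving the right end back to the first point of the level behind `C`. The value does not increase.
All diagonals of the new matching cross the cut, so they are nested and the matching is admissible
(`admissible_chords`). If a point of the level of `i` lies between `C` and `j`, the
new matching does not contain `(i, j)`, against necessity. The case of a large angle at `j` is the
mirror image, and if neither occurs, the matching by consecutive pairs of the levels is a solution
without `(i, j)`.
-/

namespace BicoloredPolygon

/-! ### Balanced sign sequences and their levels -/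

/-- The height of the walk with steps `s` after `a` steps. -/
def height (s : ℕ → ℤ) (a : ℕ) : ℤ := ∑ b ∈ Finset.range a, s b

/-- Twice the height of the middle of step `a`. Two steps of the walk have the same level if they
run, up or down, between the same two heights. -/
def level (s : ℕ → ℤ) (a : ℕ) : ℤ := height s a + height s (a + 1)

/-- All steps of the walk are `1` or `-1`. -/
def IsSign (s : ℕ → ℤ) : Prop := ∀ a, s a = 1 ∨ s a = -1

theorem height_zero (s : ℕ → ℤ) : height s 0 = 0 := by simp [height]

theorem height_succ (s : ℕ → ℤ) (a : ℕ) : height s (a + 1) = height s a + s a := by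
  simp [height, Finset.sum_range_succ]

theorem level_eq_height (s : ℕ → ℤ) (a : ℕ) : level s a = 2 * height s a + s a := by
  rw [level, height_succ]; ring

theorem height_neg (s : ℕ → ℤ) (a : ℕ) : height (-s) a = -height s a := by
  simp [height]

theorem level_neg (s : ℕ → ℤ) (a : ℕ) : level (-s) a = -level s a := by
  simp only [level, height_neg]; ring

theorem IsSign.neg {s : ℕ → ℤ} (hs : IsSign s) : IsSign (-s) := by
  intro a
  rcases hs a with h | h <;> simp [h]

/-- A walk above height `t` stays above it as long as it makes no step from `t + 1` to `t`. -/
theorem IsSign.stay_above {s : ℕ → ℤ} (hs : IsSign s) {t : ℤ} {a y : ℕ} (ha : t < height s a)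
    (hl : ∀ b, a ≤ b → b < y → level s b ≠ 2 * t + 1) : ∀ b, a ≤ b → b ≤ y → t < height s b := by
  intro b hab
  induction b, hab using Nat.le_induction with
  | base => intro _; exact ha
  | succ b hab ih =>
    intro hby
    have h1 := ih (by omega)
    have h2 := hl b hab (by omega)
    rw [level_eq_height] at h2
    rw [height_succ]
    rcases hs b with h | h <;> omega

theorem IsSign.stay_below {s : ℕ → ℤ} (hs : IsSign s) {t : ℤ} {a y : ℕ} (ha : height s a ≤ t)
    (hl : ∀ b, a ≤ b → b < y → level s b ≠ 2 * t + 1) : ∀ b, a ≤ b → b ≤ y → height s b ≤ t := by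
  intro b hab
  induction b, hab using Nat.le_induction with
  | base => intro _; exact ha
  | succ b hab ih =>
    intro hby
    have h1 := ih (by omega)
    have h2 := hl b hab (by omega)
    rw [level_eq_height] at h2
    rw [height_succ]
    rcases hs b with h | h <;> omega

/-- Consecutive steps of the same level have opposite directions. -/
theorem IsSign.alternate {s : ℕ → ℤ} (hs : IsSign s) {x z : ℕ} (hxz : x < z)
    (hl : level s x = level s z) (hn : ∀ b, x < b → b < z → level s b ≠ level s x) :
    s z = -s x := by
  have e1 := level_eq_height s x
  have e2 := level_eq_height s z
  have e3 := height_succ s x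
  rcases hs x with h | h
  · have := hs.stay_above (t := height s x) (a := x + 1) (y := z) (by omega)
      (fun b hb hb' => by have := hn b (by omega) hb'; omega) z (by omega) le_rfl
    rcases hs z with h' | h' <;> omega
  · have := hs.stay_below (t := height s x - 1) (a := x + 1) (y := z) (by omega)
      (fun b hb hb' => by have := hn b (by omega) hb'; omega) z (by omega) le_rfl
    rcases hs z with h' | h' <;> omega

theorem exists_first {p : ℕ → Prop} {a y : ℕ} (h : ∃ b, a ≤ b ∧ b < y ∧ p b) :
    ∃ b, a ≤ b ∧ b < y ∧ p b ∧ ∀ c, a ≤ c → c < b → ¬ p c := by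
  classical
  have h' : ∃ b, a ≤ b ∧ b < y ∧ p b := h
  refine ⟨Nat.find h', (Nat.find_spec h').1, (Nat.find_spec h').2.1, (Nat.find_spec h').2.2, ?_⟩
  intro c hac hc hp
  exact Nat.find_min h' hc ⟨hac, hc.trans (Nat.find_spec h').2.1, hp⟩

theorem exists_last {p : ℕ → Prop} {a y : ℕ} (h : ∃ b, a ≤ b ∧ b < y ∧ p b) :
    ∃ b, a ≤ b ∧ b < y ∧ p b ∧ ∀ c, b < c → c < y → ¬ p c := by
  obtain ⟨b, hab, hby, hp⟩ := h
  obtain ⟨d, -, hd, ⟨hpd, had, hdy⟩, hmin⟩ :=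
    exists_first (p := fun d => p (y - d) ∧ a ≤ y - d ∧ y - d < y) (a := 0) (y := y + 1)
      ⟨y - b, by omega, by omega, by rwa [Nat.sub_sub_self hby.le], by omega, by omega⟩
  refine ⟨y - d, had, hdy, hpd, fun c hc hcy hpc => ?_⟩
  refine hmin (y - c) (by omega) (by omega) ⟨?_, by omega, by omega⟩
  rwa [Nat.sub_sub_self hcy.le]

/-! ### Crossing-free matchings of a sequence -/

/-- `f` sends each of the positions `0, …, D` to its partner in a perfect crossing-free matching
that joins positions of opposite sign. -/
structure IsNoncrossing (s : ℕ → ℤ) (D : ℕ) (f : ℕ → ℕ) : Prop where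
  le : ∀ a ≤ D, f a ≤ D
  invol : ∀ a ≤ D, f (f a) = a
  opp : ∀ a ≤ D, s (f a) = -s a
  nested : ∀ a b, a ≤ D → b ≤ D → a < b → b < f a → a < f b ∧ f b < f a

namespace IsNoncrossing

variable {s : ℕ → ℤ} {D : ℕ} {f : ℕ → ℕ}

theorem ne (hs : IsSign s) (hf : IsNoncrossing s D f) {a : ℕ} (ha : a ≤ D) : f a ≠ a := by
  intro h
  have := hf.opp a ha
  rw [h] at this
  rcases hs a with h | h <;> omega

theorem inj (hf : IsNoncrossing s D f) {a b : ℕ} (ha : a ≤ D) (hb : b ≤ D) (h : f a = f b) :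
    a = b := by
  rw [← hf.invol a ha, h, hf.invol b hb]

/-- The signs of a set of positions that is closed under taking partners cancel. -/
theorem sum_eq_zero (hs : IsSign s) (hf : IsNoncrossing s D f) (S : Finset ℕ)
    (hS : ∀ a ∈ S, a ≤ D ∧ f a ∈ S) : ∑ a ∈ S, s a = 0 := by
  refine Finset.sum_involution (fun a _ => f a) ?_ ?_ ?_ ?_
  · intro a ha
    rw [hf.opp a (hS a ha).1]; ring
  · intro a ha _
    exact hf.ne hs (hS a ha).1
  · intro a ha
    exact (hS a ha).2
  · intro a ha
    exact hf.invol a (hS a ha).1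

theorem height_end (hs : IsSign s) (hf : IsNoncrossing s D f) : height s (D + 1) = 0 := by
  refine hf.sum_eq_zero hs _ fun a ha => ?_
  have ha' : a ≤ D := by simpa [Nat.lt_succ_iff] using ha
  exact ⟨ha', by have := hf.le a ha'; simp; omega⟩

theorem level_eq_of_lt (hs : IsSign s) (hf : IsNoncrossing s D f) {a : ℕ} (ha : a ≤ D)
    (h : a < f a) : level s (f a) = level s a := by
  have h0 : ∑ b ∈ Finset.Ico (a + 1) (f a), s b = 0 := by
    refine hf.sum_eq_zero hs _ fun b hb => ?_
    have hb' := Finset.mem_Ico.1 hb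
    have hbD : b ≤ D := by have := hf.le a ha; omega
    have := hf.nested a b ha hbD (by omega) hb'.2
    exact ⟨hbD, Finset.mem_Ico.2 ⟨by omega, this.2⟩⟩
  rw [Finset.sum_Ico_eq_sub _ (by omega)] at h0
  change height s (f a) - height s (a + 1) = 0 at h0
  have e1 := level_eq_height s a
  have e2 := level_eq_height s (f a)
  have e3 := height_succ s a
  have := hf.opp a ha
  omega

theorem level_eq (hs : IsSign s) (hf : IsNoncrossing s D f) {a : ℕ} (ha : a ≤ D) :
    level s (f a) = level s a := by
  rcases lt_trichotomy a (f a) with h | h | h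
  · exact hf.level_eq_of_lt hs ha h
  · exact absurd h.symm (hf.ne hs ha)
  · have := hf.level_eq_of_lt hs (hf.le a ha) (by rwa [hf.invol a ha])
    rw [hf.invol a ha] at this
    exact this.symm

theorem neg (hf : IsNoncrossing s D f) : IsNoncrossing (-s) D f :=
  ⟨hf.le, hf.invol, fun a ha => by simp [hf.opp a ha], hf.nested⟩

end IsNoncrossing

/-- The crossing-free matching given by a relation `R x y`, read as `x` being the left and `y` the
right end of a pair. -/
theorem exists_isNoncrossing_of_rel {s : ℕ → ℤ} {D : ℕ} (R : ℕ → ℕ → Prop)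
    (hlt : ∀ x y, R x y → x < y ∧ y ≤ D ∧ s y = -s x)
    (hex : ∀ z ≤ D, (∃ y, R z y) ∨ ∃ x, R x z)
    (hr : ∀ z y y', R z y → R z y' → y = y')
    (hl : ∀ x x' z, R x z → R x' z → x = x')
    (hlr : ∀ x z y, R x z → R z y → False)
    (hcr : ∀ x y x' y', R x y → R x' y' → x < x' → x' < y → y < y' → False) :
    ∃ g, IsNoncrossing s D g ∧ ∀ a ≤ D, a < g a → R a (g a) := by
  have : ∀ z, ∃ w, z ≤ D → R z w ∨ R w z := by
    intro z
    by_cases hz : z ≤ D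
    · rcases hex z hz with ⟨y, h⟩ | ⟨x, h⟩
      · exact ⟨y, fun _ => Or.inl h⟩
      · exact ⟨x, fun _ => Or.inr h⟩
    · exact ⟨0, fun h => absurd h hz⟩
  choose g hg using this
  have hg1 : ∀ a ≤ D, a < g a → R a (g a) := by
    intro a ha h
    rcases hg a ha with h' | h'
    · exact h'
    · have := hlt _ _ h'; omega
  have hle : ∀ a ≤ D, g a ≤ D := by
    intro a ha
    rcases hg a ha with h | h
    · exact (hlt _ _ h).2.1
    · have := hlt _ _ h; omega
  refine ⟨g, ⟨hle, ?_, ?_, ?_⟩, hg1⟩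
  · intro a ha
    rcases hg a ha with h | h <;> rcases hg (g a) (hle a ha) with h' | h'
    · exact (hlr _ _ _ h h').elim
    · exact hl _ _ _ h' h
    · exact hr _ _ _ h' h
    · exact (hlr _ _ _ h' h).elim
  · intro a ha
    rcases hg a ha with h | h
    · exact (hlt _ _ h).2.2
    · rw [(hlt _ _ h).2.2, neg_neg]
  · intro a b ha hb hab hbg
    have hRa := hg1 a ha (hab.trans hbg)
    rcases hg b hb with h | h
    · have h1 := hlt _ _ h
      refine ⟨by omega, ?_⟩
      by_contra hcon
      rcases (not_lt.1 hcon).lt_or_eq with h2 | h2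
      · exact hcr _ _ _ _ hRa h hab hbg h2
      · rw [← h2] at h
        have := hl _ _ _ hRa h
        omega
    · have h1 := hlt _ _ h
      refine ⟨?_, by omega⟩
      by_contra hcon
      rcases (not_lt.1 hcon).lt_or_eq with h2 | h2
      · exact hcr _ _ _ _ h hRa h2 hab hbg
      · rw [h2] at h
        have := hr _ _ _ hRa h
        omega

/-! ### Matchings that are tight away from a cut -/

/-- Position `x` is the left end of a pair of consecutive positions of its level: the walk moves
away from height `0`, or, left of the cut `C`, from the levels that are already used by the pairs
which cross the cut and start at the positions `k t`, `0 ≤ t < height s C`. -/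
def Opens (s : ℕ → ℤ) (C : ℕ) (k : ℤ → ℕ) (x : ℕ) : Prop :=
  (s x = 1 ∧ 0 ≤ height s x ∧ (x < C → height s x < height s C → x < k (height s x))) ∨
  (s x = -1 ∧ (height s (x + 1) < 0 ∨
    (x < C ∧ height s (x + 1) < height s C ∧ k (height s (x + 1)) < x)))

/-- The pair `(x, y)` consists of consecutive positions of a level on the same side of `C`. -/
def TightPair (s : ℕ → ℤ) (C : ℕ) (k : ℤ → ℕ) (x y : ℕ) : Prop :=
  (∀ b, x < b → b < y → level s b ≠ level s x) ∧ (x < C ↔ y < C) ∧ Opens s C k x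

/-- The pair `(x, y)` crosses the cut `C`, starts at one of the positions `k t` and ends at the
first position behind the cut that has the same level. -/
def CutPair (s : ℕ → ℤ) (C : ℕ) (k : ℤ → ℕ) (x y : ℕ) : Prop :=
  (∀ b, C ≤ b → b < y → level s b ≠ level s x) ∧ x < C ∧ C ≤ y ∧ s x = 1 ∧ 0 ≤ height s x ∧
    height s x < height s C ∧ x = k (height s x)

section

variable {s : ℕ → ℤ} {C D : ℕ} {k : ℤ → ℕ}

theorem CutPair.above (hs : IsSign s) {x y : ℕ} (h : CutPair s C k x y) :
    ∀ b, C ≤ b → b ≤ y → height s x < height s b := by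
  obtain ⟨h1, h2, h3, h4, h5, h6, h7⟩ := h
  refine hs.stay_above h6 fun b hb hby hlev => h1 b hb hby ?_
  rw [hlev, level_eq_height, h4]

theorem TightPair.above (hs : IsSign s) {x y : ℕ} (h : TightPair s C k x y) (hx : s x = 1) :
    ∀ b, x < b → b ≤ y → height s x < height s b := by
  refine hs.stay_above (by rw [height_succ]; omega) fun b hb hby hlev => h.1 b hb hby ?_
  rw [hlev, level_eq_height, hx]

theorem TightPair.below (hs : IsSign s) {x y : ℕ} (h : TightPair s C k x y) (hx : s x = -1) :
    ∀ b, x < b → b ≤ y → height s b ≤ height s (x + 1) := by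
  refine hs.stay_below le_rfl fun b hb hby hlev => h.1 b hb hby ?_
  rw [hlev, level_eq_height, height_succ, hx]; ring

/-- The tight pairs and the pairs across the cut form a crossing-free matching. -/
theorem exists_tight_of_selection (hs : IsSign s) (hD : height s (D + 1) = 0) (hCD : C ≤ D + 1)
    (hc : 0 ≤ height s C)
    (hk : ∀ t, 0 ≤ t → t < height s C → k t < C ∧ height s (k t) = t ∧ s (k t) = 1)
    (hmono : ∀ t t', 0 ≤ t → t < t' → t' < height s C → k t < k t') :
    ∃ g, IsNoncrossing s D g ∧
      ∀ a ≤ D, a < g a → level s a = level s (g a) ∧ (TightPair s C k a (g a) ∨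
        CutPair s C k a (g a)) := by
  have hlv := level_eq_height s
  have hsc := height_succ s
  have cut_down : ∀ x y, level s x = level s y → CutPair s C k x y → s y = -1 := by
    intro x y hl h
    have h1 := h.above hs y h.2.2.1 le_rfl
    have h4 := h.2.2.2.1
    have := hlv x; have := hlv y
    rcases hs y with h | h <;> omega
  have cut_left : ∀ x y, CutPair s C k x y → x < y := fun x y h => h.2.1.trans_le h.2.2.1
  -- A position `k t` that lies between the ends of a tight pair would have the same level.
  have key_up : ∀ x y, x < y → level s x = level s y → TightPair s C k x y → s x = 1 →
      x < C → height s x < height s C → x < k (height s x) ∧ y < k (height s x) := by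
    intro x y hxy hl h hx hxC hxc
    rcases h.2.2 with ⟨h1, h2, h3⟩ | ⟨h1, -⟩
    · have h4 := h3 hxC hxc
      obtain ⟨h5, h6, h7⟩ := hk _ h2 hxc
      refine ⟨h4, ?_⟩
      by_contra hcon
      rcases (not_lt.1 hcon).lt_or_eq with h8 | h8
      · refine h.1 _ h4 h8 ?_
        rw [hlv, hlv, h6, h7, hx]
      · have := hs.alternate hxy hl h.1
        rw [h8] at h7
        omega
    · omega
  suffices h : ∃ g, IsNoncrossing s D g ∧ ∀ a ≤ D, a < g a → a < g a ∧ g a ≤ D ∧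
      level s a = level s (g a) ∧ (TightPair s C k a (g a) ∨ CutPair s C k a (g a)) by
    obtain ⟨g, hg, hgR⟩ := h
    exact ⟨g, hg, fun a ha h => (hgR a ha h).2.2⟩
  refine exists_isNoncrossing_of_rel
    (fun x y => x < y ∧ y ≤ D ∧ level s x = level s y ∧ (TightPair s C k x y ∨ CutPair s C k x y))
    ?_ ?_ ?_ ?_ ?_ ?_
  · rintro x y ⟨h1, h2, h3, h4⟩
    refine ⟨h1, h2, ?_⟩
    rcases h4 with h4 | h4
    · exact hs.alternate h1 h3 h4.1
    · rw [cut_down x y h3 h4, h4.2.2.2.1]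
  · intro z hz
    -- The first and the last position of the level of `z` behind and before `z`.
    have first : ∀ y, z < y → y ≤ D + 1 → (z < C → y ≤ C) → Opens s C k z →
        (∃ b, z + 1 ≤ b ∧ b < y ∧ level s b = level s z) →
        ∃ y, z < y ∧ y ≤ D ∧ level s z = level s y ∧
          (TightPair s C k z y ∨ CutPair s C k z y) := by
      intro y hzy hyD hyC ho hb
      obtain ⟨b, hb1, hb2, hb3, hb4⟩ := exists_first hb
      exact ⟨b, by omega, by omega, hb3.symm, Or.inl
        ⟨fun c hc hcb => hb4 c (by omega) hcb, by omega, ho⟩⟩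
    have last : ∀ x, x ≤ z → (C ≤ z → C ≤ x) →
        (∀ b, x ≤ b → b < z → level s b = level s z → s b = - s z → Opens s C k b) →
        (∃ b, x ≤ b ∧ b < z ∧ level s b = level s z) →
        ∃ x, x < z ∧ z ≤ D ∧ level s x = level s z ∧
          (TightPair s C k x z ∨ CutPair s C k x z) := by
      intro x hxz hxC ho hb
      obtain ⟨b, hb1, hb2, hb3, hb4⟩ := exists_last hb
      have h1 : ∀ c, b < c → c < z → level s c ≠ level s b :=
        fun c hc hcz => by rw [hb3]; exact hb4 c hc hcz
      refine ⟨b, hb2, hz, hb3, Or.inl ⟨h1, by omega, ho b hb1 hb2 hb3 ?_⟩⟩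
      have := hs.alternate hb2 hb3 h1
      omega
    have hlz := hlv z
    have hsz := hsc z
    have h0 := height_zero s
    rcases hs z with hz1 | hz1
    · -- `z` is an up-step from height `t = height s z`
      have up : ∀ y, z < y → y ≤ D + 1 → (z < C → y ≤ C) → Opens s C k z →
          height s y ≤ height s z → ∃ y, z < y ∧ y ≤ D ∧ level s z = level s y ∧
          (TightPair s C k z y ∨ CutPair s C k z y) := by
        intro y h1 h2 h3 h4 h5
        refine first y h1 h2 h3 h4 ?_
        by_contra hcon
        push Not at hcon
        have := hs.stay_above (t := height s z) (a := z + 1) (y := y) (by omega)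
          (fun b hb hb' => by have := hcon b hb hb'; omega) y (by omega) le_rfl
        omega
      have up' : ∀ x, x ≤ z → (C ≤ z → C ≤ x) →
          (∀ b, x ≤ b → b < z → level s b = level s z → s b = -1 → Opens s C k b) →
          height s z < height s x → ∃ x, x < z ∧ z ≤ D ∧ level s x = level s z ∧
          (TightPair s C k x z ∨ CutPair s C k x z) := by
        intro x h1 h2 h3 h4
        refine last x h1 h2 (fun b hb hb' h h' => h3 b hb hb' h (by omega)) ?_
        by_contra hcon
        push Not at hcon
        have := hs.stay_above (t := height s z) (a := x) (y := z) (by omega)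
          (fun b hb hb' => by have := hcon b hb hb'; omega) z (by omega) le_rfl
        omega
      rcases lt_or_ge (height s z) 0 with ht | ht
      · right
        have ho : ∀ b, level s b = level s z → s b = -1 → Opens s C k b := by
          intro b h h'
          refine Or.inr ⟨h', Or.inl ?_⟩
          have := hlv b; have := hsc b
          omega
        rcases lt_or_ge z C with hzC | hzC
        · exact up' 0 (by omega) (by omega) (fun b _ _ h h' => ho b h h') (by omega)
        · exact up' C (by omega) (by omega) (fun b _ _ h h' => ho b h h') (by omega)
      · rcases lt_or_ge z C with hzC | hzC
        · rcases lt_or_ge (height s z) (height s C) with htc | htc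
          · obtain ⟨h1, h2, h3⟩ := hk _ ht htc
            rcases lt_trichotomy z (k (height s z)) with hzk | hzk | hzk
            · left
              exact up (k (height s z)) hzk (by omega) (by omega)
                (Or.inl ⟨hz1, ht, fun _ _ => hzk⟩) (by omega)
            · left
              have hb : ∃ b, C ≤ b ∧ b < D + 1 ∧ level s b = level s z := by
                by_contra hcon
                push Not at hcon
                have := hs.stay_above (t := height s z) (a := C) (y := D + 1) htc
                  (fun b hb hb' => by have := hcon b hb hb'; omega) (D + 1) hCD le_rfl
                omega
              obtain ⟨b, hb1, hb2, hb3, hb4⟩ := exists_first hb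
              exact ⟨b, by omega, by omega, hb3.symm, Or.inr ⟨hb4, hzC, hb1, hz1, ht, htc, hzk⟩⟩
            · right
              refine up' (k (height s z) + 1) hzk (by omega) ?_ (by rw [hsc, h2, h3]; omega)
              intro b hb hb' h h'
              have e1 := hlv b; have e2 := hsc b
              have e3 : height s (b + 1) = height s z := by omega
              exact Or.inr ⟨h', Or.inr ⟨by omega, by omega, by rw [e3]; omega⟩⟩
          · left
            exact up C hzC hCD (by omega) (Or.inl ⟨hz1, ht, by omega⟩) htc
        · left
          exact up (D + 1) (by omega) le_rfl (by omega) (Or.inl ⟨hz1, ht, by omega⟩) (by omega)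
    · -- `z` is a down-step to height `t = height s (z + 1)`
      have down : ∀ y, z < y → y ≤ D + 1 → (z < C → y ≤ C) → Opens s C k z →
          height s (z + 1) < height s y → ∃ y, z < y ∧ y ≤ D ∧ level s z = level s y ∧
          (TightPair s C k z y ∨ CutPair s C k z y) := by
        intro y h1 h2 h3 h4 h5
        refine first y h1 h2 h3 h4 ?_
        by_contra hcon
        push Not at hcon
        have := hs.stay_below (t := height s (z + 1)) (a := z + 1) (y := y) le_rfl
          (fun b hb hb' => by have := hcon b hb hb'; omega) y (by omega) le_rfl
        omega
      have down' : ∀ x, x ≤ z → (C ≤ z → C ≤ x) →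
          (∀ b, x ≤ b → b < z → level s b = level s z → s b = 1 → Opens s C k b) →
          height s x ≤ height s (z + 1) → ∃ x, x < z ∧ z ≤ D ∧ level s x = level s z ∧
          (TightPair s C k x z ∨ CutPair s C k x z) := by
        intro x h1 h2 h3 h4
        refine last x h1 h2 (fun b hb hb' h h' => h3 b hb hb' h (by omega)) ?_
        by_contra hcon
        push Not at hcon
        have := hs.stay_below (t := height s (z + 1)) (a := x) (y := z) h4
          (fun b hb hb' => by have := hcon b hb hb'; omega) z (by omega) le_rfl
        omega
      rcases lt_or_ge (height s (z + 1)) 0 with ht | ht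
      · left
        rcases lt_or_ge z C with hzC | hzC
        · exact down C hzC hCD (by omega) (Or.inr ⟨hz1, Or.inl ht⟩) (by omega)
        · exact down (D + 1) (by omega) le_rfl (by omega) (Or.inr ⟨hz1, Or.inl ht⟩) (by omega)
      · rcases lt_or_ge z C with hzC | hzC
        · rcases lt_or_ge (height s (z + 1)) (height s C) with htc | htc
          · obtain ⟨h1, h2, h3⟩ := hk _ ht htc
            rcases lt_trichotomy z (k (height s (z + 1))) with hzk | hzk | hzk
            · right
              refine down' 0 (by omega) (by omega) ?_ (by omega)
              intro b hb hb' h h'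
              have e1 := hlv b
              have e3 : height s b = height s (z + 1) := by omega
              exact Or.inl ⟨h', by omega, fun _ _ => by rw [e3]; omega⟩
            · rw [← hzk] at h3; omega
            · left
              exact down C hzC hCD (by omega) (Or.inr ⟨hz1, Or.inr ⟨hzC, htc, hzk⟩⟩) htc
          · right
            refine down' 0 (by omega) (by omega) ?_ (by omega)
            intro b hb hb' h h'
            have e1 := hlv b
            exact Or.inl ⟨h', by omega, by omega⟩
        · right
          have ho : ∀ b, C ≤ b → level s b = level s z → s b = 1 → Opens s C k b := by
            intro b hb h h'
            have := hlv b
            exact Or.inl ⟨h', by omega, by omega⟩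
          rcases lt_or_ge (height s (z + 1)) (height s C) with htc | htc
          · obtain ⟨h1, h2, h3⟩ := hk _ ht htc
            by_cases hb : ∃ b, C ≤ b ∧ b < z ∧ level s b = level s z
            · exact last C hzC (by omega) (fun b hb _ h h' => ho b hb h (by omega)) hb
            · push Not at hb
              refine ⟨k (height s (z + 1)), by omega, hz, ?_, Or.inr ⟨?_, h1, hzC, h3, ?_⟩⟩
              · rw [hlv, hlv, h2, h3]; omega
              · intro b hb1 hb2 hb3
                refine hb b hb1 hb2 ?_
                rw [hb3, hlv, hlv, h2, h3]; omega
              · rw [h2]; exact ⟨ht, htc, rfl⟩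
          · exact down' C hzC (by omega) (fun b hb _ h h' => ho b hb h h') htc
  · -- the right end is determined by the left end
    rintro z y y' ⟨h1, h2, h3, h4⟩ ⟨h1', h2', h3', h4'⟩
    have mixed : TightPair s C k z y → CutPair s C k z y' → False := by
      intro h h'
      have := key_up z y h1 h3 h h'.2.2.2.1 h'.2.1 h'.2.2.2.2.2.1
      have := h'.2.2.2.2.2.2
      omega
    have mixed' : TightPair s C k z y' → CutPair s C k z y → False := by
      intro h h'
      have := key_up z y' h1' h3' h h'.2.2.2.1 h'.2.1 h'.2.2.2.2.2.1
      have := h'.2.2.2.2.2.2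
      omega
    rcases h4 with h4 | h4 <;> rcases h4' with h4' | h4'
    · rcases lt_trichotomy y y' with h | h | h
      · exact (h4'.1 y h1 h h3.symm).elim
      · exact h
      · exact (h4.1 y' h1' h h3'.symm).elim
    · exact (mixed h4 h4').elim
    · exact (mixed' h4' h4).elim
    · rcases lt_trichotomy y y' with h | h | h
      · exact (h4'.1 y h4.2.2.1 h h3.symm).elim
      · exact h
      · exact (h4.1 y' h4'.2.2.1 h h3'.symm).elim
  · -- the left end is determined by the right end
    rintro x x' z ⟨h1, h2, h3, h4⟩ ⟨h1', h2', h3', h4'⟩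
    rcases h4 with h4 | h4 <;> rcases h4' with h4' | h4'
    · rcases lt_trichotomy x x' with h | h | h
      · exact (h4.1 x' h h1' (by omega)).elim
      · exact h
      · exact (h4'.1 x h h1 (by omega)).elim
    · have := h4.2.1; have := h4'.2.2.1
      exact (h4'.1 x (by omega) h1 (by omega)).elim
    · have := h4'.2.1; have := h4.2.2.1
      exact (h4.1 x' (by omega) h1' (by omega)).elim
    · have e1 := hlv x; have e2 := hlv x'
      have := h4.2.2.2.1; have := h4'.2.2.2.1
      have e3 : height s x = height s x' := by omega
      rw [h4.2.2.2.2.2.2, h4'.2.2.2.2.2.2, e3]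
  · -- no position is a left and a right end
    rintro x z y ⟨h1, h2, h3, h4⟩ ⟨h1', h2', h3', h4'⟩
    have e1 := hlv x; have e2 := hlv z; have e3 := hsc x; have e4 := hsc z
    rcases h4 with h4 | h4
    · have hz := hs.alternate h1 h3 h4.1
      have hside := h4.2.1
      rcases h4.2.2 with ⟨o1, o2, o3⟩ | ⟨o1, o2⟩
      · rcases h4' with h4' | h4'
        · rcases h4'.2.2 with ⟨p1, -⟩ | ⟨p1, p2 | ⟨p2, p3, p4⟩⟩
          · omega
          · omega
          · have e5 : height s (z + 1) = height s x := by omega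
            rw [e5] at p4 p3
            have := key_up x z h1 h3 h4 o1 (by omega) p3
            omega
        · have := h4'.2.2.2.1; omega
      · have e5 : height s z = height s (x + 1) := by omega
        have hz1 : s z = 1 := by omega
        rcases h4' with h4' | h4'
        · rcases h4'.2.2 with ⟨p1, p2, p3⟩ | ⟨p1, -⟩
          · rcases o2 with o2 | ⟨o2, o4, o5⟩
            · omega
            · have := p3 (by omega) (by omega)
              rw [e5] at this
              omega
          · omega
        · obtain ⟨q1, q2, q3, q4, q5, q6, q7⟩ := h4'
          rcases o2 with o2 | ⟨o2, o4, o5⟩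
          · omega
          · rw [e5] at q7; omega
    · have hz := cut_down x z h3 h4
      have hzC := h4.2.2.1
      have hx0 := h4.2.2.2.2.1
      have hx1 := h4.2.2.2.1
      rcases h4' with h4' | h4'
      · rcases h4'.2.2 with ⟨p1, -⟩ | ⟨p1, p2 | ⟨p2, p3, p4⟩⟩ <;> omega
      · have := h4'.2.1; omega
  · -- no crossings
    rintro x y x' y' ⟨h1, h2, h3, h4⟩ ⟨h1', h2', h3', h4'⟩ hxx hxy hyy
    have e1 := hlv x; have e2 := hlv x'; have e3 := hsc x; have e4 := hsc x'
    have e5 := hlv y; have e6 := hsc y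
    rcases h4 with h4 | h4
    · have hz := hs.alternate h1 h3 h4.1
      have hside := h4.2.1
      rcases h4.2.2 with ⟨o1, o2, o3⟩ | ⟨o1, o2⟩
      · have a1 := h4.above hs o1 x' hxx hxy.le
        have a2 := h4.above hs o1 (x' + 1) (by omega) (by omega)
        rcases h4' with h4' | h4'
        · rcases h4'.2.2 with ⟨p1, -⟩ | ⟨p1, p2 | ⟨p2, p3, p4⟩⟩
          · have := h4'.above hs p1 (y + 1) (by omega) (by omega)
            omega
          · omega
          · have := key_up x y h1 h3 h4 o1 (by omega) (by omega)
            have := hmono (height s x) (height s (x' + 1)) o2 a2 p3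
            omega
        · obtain ⟨q1, q2, q3, q4, q5, q6, q7⟩ := h4'
          have := key_up x y h1 h3 h4 o1 (by omega) (by omega)
          have := hmono (height s x) (height s x') o2 a1 q6
          omega
      · have a1 := h4.below hs o1 x' hxx hxy.le
        have a2 := h4.below hs o1 (x' + 1) (by omega) (by omega)
        rcases h4' with h4' | h4'
        · rcases h4'.2.2 with ⟨p1, p2, p3⟩ | ⟨p1, -⟩
          · rcases o2 with o2 | ⟨o2, o4, o5⟩
            · omega
            · have := p3 (by omega) (by omega)
              have := hmono (height s x') (height s (x + 1)) p2 (by omega) o4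
              omega
          · have := h4'.below hs p1 (y + 1) (by omega) (by omega)
            omega
        · obtain ⟨q1, q2, q3, q4, q5, q6, q7⟩ := h4'
          rcases o2 with o2 | ⟨o2, o4, o5⟩
          · omega
          · have := hmono (height s x') (height s (x + 1)) q5 (by omega) o4
            omega
    · have hz := cut_down x y h3 h4
      have habove := h4.above hs
      obtain ⟨r1, r2, r3, r4, r5, r6, r7⟩ := h4
      rcases h4' with h4' | h4'
      · have hside := h4'.2.1
        have a1 := habove x' (by omega) hxy.le
        have a2 := habove (x' + 1) (by omega) (by omega)
        rcases h4'.2.2 with ⟨p1, p2, p3⟩ | ⟨p1, p2 | ⟨p2, p3, p4⟩⟩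
        · have := h4'.above hs p1 (y + 1) (by omega) (by omega)
          omega
        · omega
        · omega
      · have a1 := h4'.above hs (y + 1) (by omega) (by omega)
        obtain ⟨q1, q2, q3, q4, q5, q6, q7⟩ := h4'
        have := hmono (height s x') (height s x) q5 (by omega) r6
        omega

/-- A matching in which all pairs join consecutive positions of a level. -/
theorem exists_tight (hs : IsSign s) (hD : height s (D + 1) = 0) :
    ∃ g, IsNoncrossing s D g ∧
      ∀ a ≤ D, a < g a → ∀ b, a < b → b < g a → level s b ≠ level s a := by
  obtain ⟨g, hg, h⟩ := exists_tight_of_selection (s := s) (C := D + 1) (D := D) (k := fun _ => 0)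
    hs hD le_rfl hD.ge (fun t h1 h2 => by omega) (fun t t' h1 h2 h3 => by omega)
  refine ⟨g, hg, fun a ha hag => ?_⟩
  rcases (h a ha hag).2 with h' | h'
  · exact h'.1
  · have := h'.2.2.1
    have := hg.le a ha
    omega

theorem exists_straightened_of_nonneg (hs : IsSign s) {f : ℕ → ℕ} (hf : IsNoncrossing s D f)
    (hCD : C ≤ D + 1) (hc : 0 ≤ height s C) :
    ∃ g, IsNoncrossing s D g ∧
      (∀ a ≤ D, a < g a → (a < C ↔ g a < C) → ∀ b, a < b → b < g a → level s b ≠ level s a) ∧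
      (∀ a < C, C ≤ g a → g a ≤ f a ∧ ∀ b, C ≤ b → b < g a → level s b ≠ level s a) := by
  classical
  -- the walk made of the left ends of the pairs of `f` that cross the cut
  set w : ℕ → ℤ := fun x => ∑ a ∈ (Finset.range x).filter (fun a => C ≤ f a), s a with hw
  have hw_succ : ∀ x, w (x + 1) = w x + if C ≤ f x then s x else 0 := by
    intro x
    simp only [hw, Finset.range_add_one, Finset.filter_insert]
    split_ifs with h
    · rw [Finset.sum_insert (by simp)]; ring
    · ring
  have hw_height : ∀ x ≤ C, (∀ a < x, f a < C → f a < x) → height s x = w x := by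
    intro x hx h
    have h0 : ∑ a ∈ (Finset.range x).filter (fun a => ¬ C ≤ f a), s a = 0 := by
      refine hf.sum_eq_zero hs _ fun a ha => ?_
      simp only [Finset.mem_filter, Finset.mem_range, not_le] at ha ⊢
      exact ⟨by omega, h a ha.1 ha.2, by rw [hf.invol a (by omega)]; omega⟩
    rw [height, ← Finset.sum_filter_add_sum_filter_not _ (fun a => C ≤ f a), h0, add_zero]
  have hwC : w C = height s C := (hw_height C le_rfl fun a _ h => h).symm
  have hw_cross : ∀ x < C, C ≤ f x → height s x = w x := by
    intro x hx hfx
    refine hw_height x hx.le fun a ha hfa => ?_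
    by_contra hcon
    rcases (not_lt.1 hcon).lt_or_eq with h | h
    · have := hf.nested a x (by omega) (by omega) ha h; omega
    · rw [h, hf.invol a (by omega)] at hfx; omega
  have hex : ∀ t, 0 ≤ t → t < height s C → ∃ x, t < w (x + 1) := by
    intro t h0 h1
    obtain ⟨x, rfl⟩ : ∃ x, C = x + 1 := ⟨C - 1, by
      have : C ≠ 0 := by rintro rfl; rw [height_zero] at h1; omega
      omega⟩
    exact ⟨x, by rw [hwC]; exact h1⟩
  set k : ℤ → ℕ := fun t => if h : ∃ x, t < w (x + 1) then Nat.find h else 0 with hkdef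
  have hk1 : ∀ t, 0 ≤ t → t < height s C → t < w (k t + 1) ∧ ∀ x, t < w (x + 1) → k t ≤ x := by
    intro t h0 h1
    have h := hex t h0 h1
    simp only [hkdef, dif_pos h]
    exact ⟨Nat.find_spec h, fun x hx => Nat.find_min' h hx⟩
  have hk2 : ∀ t, 0 ≤ t → t < height s C → w (k t) ≤ t := by
    intro t h0 h1
    obtain ⟨h2, h3⟩ := hk1 t h0 h1
    by_contra hcon
    cases hx : k t with
    | zero => rw [hx] at hcon; simp [hw] at hcon; omega
    | succ x =>
      rw [hx] at hcon
      have := h3 x (by omega)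
      omega
  have hk3 : ∀ t, 0 ≤ t → t < height s C →
      k t < C ∧ C ≤ f (k t) ∧ w (k t) = t ∧ s (k t) = 1 := by
    intro t h0 h1
    obtain ⟨h2, h3⟩ := hk1 t h0 h1
    have h4 := hk2 t h0 h1
    have h5 : k t < C := by
      have hC : C ≠ 0 := by rintro rfl; rw [height_zero] at h1; omega
      have := h3 (C - 1) (by rw [Nat.sub_add_cancel (by omega), hwC]; exact h1)
      omega
    have h6 := hw_succ (k t)
    split_ifs at h6 with h7
    · rcases hs (k t) with h | h
      · exact ⟨h5, h7, by omega, h⟩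
      · omega
    · omega
  obtain ⟨g, hg, h⟩ := exists_tight_of_selection (s := s) (C := C) (D := D) (k := k) hs
    (hf.height_end hs) hCD hc
    (fun t h0 h1 => by
      obtain ⟨h2, h3, h4, h5⟩ := hk3 t h0 h1
      exact ⟨h2, by rw [hw_cross _ h2 h3, h4], h5⟩)
    (fun t t' h0 h1 h2 => by
      have h3 := (hk1 t h0 (h1.trans h2)).2 (k t')
        (h1.trans (hk1 t' (h0.trans h1.le) h2).1)
      have h4 := (hk3 t h0 (h1.trans h2)).2.2.1
      have h5 := (hk3 t' (h0.trans h1.le) h2).2.2.1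
      rcases h3.lt_or_eq with h6 | h6
      · exact h6
      · rw [h6] at h4; omega)
  refine ⟨g, hg, ?_, ?_⟩
  · intro a ha hag hside
    rcases (h a ha hag).2 with h' | h'
    · exact h'.1
    · have := h'.2.1; have := h'.2.2.1; omega
  · intro a ha hag
    have haD : a ≤ D := by omega
    rcases (h a haD (by omega)).2 with h' | h'
    · have := h'.2.1; omega
    · obtain ⟨q1, q2, q3, q4, q5, q6, q7⟩ := h'
      refine ⟨?_, q1⟩
      by_contra hcon
      have h1 := (hk3 _ q5 q6).2.1
      rw [← q7] at h1
      exact q1 (f a) h1 (by omega) (hf.level_eq hs haD)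

/-- Given a matching `f` and a cut `C`, there is a matching `g` whose pairs join consecutive
positions of a level, except for pairs `(a, g a)` across the cut. These are obtained from pairs
`(a, f a)` by moving the right end to the left, to the first position of the level behind the
cut. -/
theorem exists_straightened (hs : IsSign s) {f : ℕ → ℕ} (hf : IsNoncrossing s D f)
    (hCD : C ≤ D + 1) :
    ∃ g, IsNoncrossing s D g ∧
      (∀ a ≤ D, a < g a → (a < C ↔ g a < C) → ∀ b, a < b → b < g a → level s b ≠ level s a) ∧
      (∀ a < C, C ≤ g a → g a ≤ f a ∧ ∀ b, C ≤ b → b < g a → level s b ≠ level s a) := by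
  rcases le_total 0 (height s C) with hc | hc
  · exact exists_straightened_of_nonneg hs hf hCD hc
  · obtain ⟨g, hg, h1, h2⟩ := exists_straightened_of_nonneg hs.neg hf.neg hCD
      (by rw [height_neg]; omega)
    refine ⟨g, by simpa using hg.neg, ?_, ?_⟩
    · intro a ha hag hside b hb hb' h
      exact h1 a ha hag hside b hb hb' (by rw [level_neg, level_neg, h])
    · intro a ha hag
      refine ⟨(h2 a ha hag).1, fun b hb hb' h => ?_⟩
      exact (h2 a ha hag).2 b hb hb' (by rw [level_neg, level_neg, h])

end

/-! ### Reversing the sequence -/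

section

variable {s : ℕ → ℤ} {C D : ℕ}

theorem height_reverse (s : ℕ → ℤ) {a : ℕ} (ha : a ≤ D + 1) :
    height (fun b => s (D - b)) a = height s (D + 1) - height s (D + 1 - a) := by
  induction a with
  | zero => simp [height_zero]
  | succ a ih =>
    rw [height_succ, ih (by omega)]
    have h := height_succ s (D - a)
    rw [show D - a + 1 = D + 1 - a by omega] at h
    rw [h, show D + 1 - (a + 1) = D - a by omega]
    ring

theorem level_reverse (hD : height s (D + 1) = 0) {a : ℕ} (ha : a ≤ D) :
    level (fun b => s (D - b)) a = -level s (D - a) := by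
  rw [level, height_reverse s (by omega), height_reverse s (by omega), hD, level,
    show D + 1 - (a + 1) = D - a by omega, show D + 1 - a = D - a + 1 by omega]
  ring

theorem IsNoncrossing.reverse {f : ℕ → ℕ} (hf : IsNoncrossing s D f) :
    IsNoncrossing (fun a => s (D - a)) D (fun a => D - f (D - a)) := by
  have hle : ∀ a, f (D - a) ≤ D := fun a => hf.le _ (by omega)
  refine ⟨fun a _ => by omega, fun a ha => ?_, fun a ha => ?_, fun a b ha hb hab hba => ?_⟩
  · rw [Nat.sub_sub_self (hle a), hf.invol _ (by omega)]
    omega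
  · rw [Nat.sub_sub_self (hle a), hf.opp _ (by omega)]
  · have h1 := hle a
    have h2 := hle b
    have h3 := hf.nested (f (D - a)) (D - b) h1 (by omega) (by omega)
      (by rw [hf.invol _ (by omega)]; omega)
    rw [hf.invol _ (by omega)] at h3
    omega

/-- The mirror image of `exists_straightened`: here the left ends of the pairs across the cut are
moved to the right. -/
theorem exists_straightened_left (hs : IsSign s) {f : ℕ → ℕ} (hf : IsNoncrossing s D f)
    (hCD : C ≤ D + 1) :
    ∃ g, IsNoncrossing s D g ∧
      (∀ a ≤ D, a < g a → (a < C ↔ g a < C) → ∀ b, a < b → b < g a → level s b ≠ level s a) ∧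
      (∀ a < C, C ≤ g a → f (g a) ≤ a ∧ ∀ b, a < b → b < C → level s b ≠ level s a) := by
  have hD := hf.height_end hs
  have hs' : IsSign (fun a => s (D - a)) := fun a => hs _
  obtain ⟨g, hg, h1, h2⟩ := exists_straightened (C := D + 1 - C) hs' hf.reverse (by omega)
  have hgr : IsNoncrossing s D (fun a => D - g (D - a)) := by
    have := hg.reverse
    refine ⟨this.le, this.invol, fun a ha => ?_, this.nested⟩
    have h := this.opp a ha
    rwa [Nat.sub_sub_self (by omega), Nat.sub_sub_self ha] at h
  have hle : ∀ a, g (D - a) ≤ D := fun a => hg.le _ (by omega)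
  have hlev : ∀ a ≤ D, level s (D - g (D - a)) = level s a := fun a ha => hgr.level_eq hs ha
  refine ⟨_, hgr, ?_, ?_⟩
  · intro a ha hag hside b hb hb' hl
    have h3 := hle a
    have h4 := hg.invol (D - a) (by omega)
    have h5 := h1 (g (D - a)) h3 (by omega) (by omega) (D - b) (by omega) (by omega)
    rw [level_reverse hD (by omega), level_reverse hD h3, Nat.sub_sub_self (by omega), hlev a ha,
      hl] at h5
    exact h5 rfl
  · intro a ha hag
    have h3 := hle a
    by_cases hgD : a ≤ D
    swap
    · omega
    have h4 := hg.invol (D - a) (by omega)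
    obtain ⟨h5, h6⟩ := h2 (g (D - a)) (by omega) (by omega)
    rw [h4] at h5
    have h7 := hf.le (D - g (D - a)) (by omega)
    refine ⟨by omega, fun b hb hb' hl => ?_⟩
    have h8 := h6 (D - b) (by omega) (by omega)
    rw [level_reverse hD (by omega), level_reverse hD h3, Nat.sub_sub_self (by omega), hlev a hgD,
      hl] at h8
    exact h8 rfl

end

/-! ### Chords of a convex chain of small turning angle -/

/-- The cross product of two plane vectors. -/
def cross (a b : ℂ) : ℝ := a.re * b.im - a.im * b.re

/-- `V 0, …, V D` are consecutive vertices of a convex polygon in counterclockwise order, and the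
first edge has to be turned by at most `2π/3` to align with the last one. -/
structure ConvexChain (V : ℕ → ℂ) (D : ℕ) : Prop where
  three_le : 3 ≤ D
  orient : ∀ a b c, a < b → b < c → c ≤ D → 0 < cross (V b - V a) (V c - V a)
  arg_nonneg : 0 ≤ Complex.arg ((V D - V (D - 1)) / (V 1 - V 0))
  arg_le : Complex.arg ((V D - V (D - 1)) / (V 1 - V 0)) ≤ 2 * Real.pi / 3

/-- The direction of the chord from `V a` to `V b`, measured from the first edge. -/
noncomputable def dir (V : ℕ → ℂ) (a b : ℕ) : ℝ := Complex.arg ((V b - V a) / (V 1 - V 0))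

theorem cross_eq (a b : ℂ) : cross a b = ‖a‖ * ‖b‖ * Real.sin (Complex.arg b - Complex.arg a) := by
  rw [Real.sin_sub, cross]
  have h1 := Complex.norm_mul_cos_arg a
  have h2 := Complex.norm_mul_sin_arg a
  have h3 := Complex.norm_mul_cos_arg b
  have h4 := Complex.norm_mul_sin_arg b
  nth_rewrite 1 [← h1, ← h2, ← h3, ← h4]
  ring

theorem cross_div {u : ℂ} (hu : u ≠ 0) (a b : ℂ) :
    cross a b = Complex.normSq u * cross (a / u) (b / u) := by
  have ha : a = a / u * u := by field_simp
  have hb : b = b / u * u := by field_simp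
  conv_lhs => rw [ha, hb]
  simp only [cross, Complex.mul_re, Complex.mul_im, Complex.normSq_apply]
  ring

/-- The dot product of two plane vectors. -/
def dot (a b : ℂ) : ℝ := a.re * b.re + a.im * b.im

theorem dot_eq (a b : ℂ) : dot a b = ‖a‖ * ‖b‖ * Real.cos (Complex.arg b - Complex.arg a) := by
  rw [Real.cos_sub, dot]
  have h1 := Complex.norm_mul_cos_arg a
  have h2 := Complex.norm_mul_sin_arg a
  have h3 := Complex.norm_mul_cos_arg b
  have h4 := Complex.norm_mul_sin_arg b
  nth_rewrite 1 [← h1, ← h2, ← h3, ← h4]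
  ring

theorem add_cross_eq (a b : ℂ) : √3 * dot a b + cross a b =
    2 * (‖a‖ * ‖b‖) * Real.sin (Complex.arg b - Complex.arg a + Real.pi / 3) := by
  rw [dot_eq, cross_eq, Real.sin_add, Real.cos_pi_div_three, Real.sin_pi_div_three]
  ring

theorem sub_cross_eq (a b : ℂ) : √3 * dot a b - cross a b =
    2 * (‖a‖ * ‖b‖) * Real.sin (Real.pi / 3 - (Complex.arg b - Complex.arg a)) := by
  rw [dot_eq, cross_eq, Real.sin_sub (Real.pi / 3), Real.cos_pi_div_three,
    Real.sin_pi_div_three]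
  ring

theorem norm_lt_norm_add_of_dot {a b : ℂ} (h : 0 < dot a (a + b) + dot a b) : ‖b‖ < ‖a + b‖ := by
  rw [← sq_lt_sq₀ (norm_nonneg _) (norm_nonneg _), ← Complex.normSq_eq_norm_sq,
    ← Complex.normSq_eq_norm_sq]
  simp only [dot, Complex.add_re, Complex.add_im, Complex.normSq_apply] at *
  nlinarith

theorem norm_le_norm_add_of_dot {a b : ℂ} (h : 0 ≤ dot a (a + b) + dot a b) : ‖b‖ ≤ ‖a + b‖ := by
  rw [← sq_le_sq₀ (norm_nonneg _) (norm_nonneg _), ← Complex.normSq_eq_norm_sq,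
    ← Complex.normSq_eq_norm_sq]
  simp only [dot, Complex.add_re, Complex.add_im, Complex.normSq_apply] at *
  nlinarith

theorem add_cross_nonneg {a b : ℂ} (h1 : 0 ≤ Complex.arg b - Complex.arg a)
    (h2 : Complex.arg b - Complex.arg a ≤ 2 * Real.pi / 3) : 0 ≤ √3 * dot a b + cross a b := by
  rw [add_cross_eq]
  have := Real.sin_nonneg_of_nonneg_of_le_pi
    (x := Complex.arg b - Complex.arg a + Real.pi / 3) (by linarith [Real.pi_pos]) (by linarith)
  positivity

theorem sub_cross_nonneg {a b : ℂ} (h1 : 0 ≤ Complex.arg b - Complex.arg a)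
    (h2 : Complex.arg b - Complex.arg a ≤ Real.pi / 3) : 0 ≤ √3 * dot a b - cross a b := by
  rw [sub_cross_eq]
  have := Real.sin_nonneg_of_nonneg_of_le_pi
    (x := Real.pi / 3 - (Complex.arg b - Complex.arg a)) (by linarith)
    (by linarith [Real.pi_pos])
  positivity

theorem sub_cross_pos {a b : ℂ} (ha : a ≠ 0) (hb : b ≠ 0)
    (h1 : 0 ≤ Complex.arg b - Complex.arg a)
    (h2 : Complex.arg b - Complex.arg a < Real.pi / 3) : 0 < √3 * dot a b - cross a b := by
  rw [sub_cross_eq]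
  have := Real.sin_pos_of_pos_of_lt_pi
    (x := Real.pi / 3 - (Complex.arg b - Complex.arg a)) (by linarith)
    (by linarith [Real.pi_pos])
  have := norm_pos_iff.2 ha
  have := norm_pos_iff.2 hb
  positivity

theorem cross_self_add (a b : ℂ) : cross a (a + b) = cross a b := by
  simp [cross]; ring

theorem cross_add_self (a b : ℂ) : cross (a + b) b = cross a b := by
  simp [cross]; ring

theorem dot_comm (a b : ℂ) : dot a b = dot b a := by
  simp [dot]; ring

namespace ConvexChain

variable {V : ℕ → ℂ} {D : ℕ}

/-- The values of a linear functional at the vertices of a convex polygon are unimodal: at the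
vertices `p, a, b, c`, if the value at `b` is at least that at `p` and at most that at `c`, then it
is at least that at `a`. -/
theorem cross_mono (hV : ConvexChain V D) (u : ℂ) {p a b c : ℕ} (hpa : p < a) (hab : a < b)
    (hbc : b < c) (hc : c ≤ D) (h1 : 0 ≤ cross u (V b - V p)) (h2 : 0 ≤ cross u (V c - V b)) :
    0 ≤ cross u (V b - V a) := by
  have o1 := hV.orient a b c hab hbc hc
  have o2 := hV.orient p a c hpa (hab.trans hbc) hc
  have o3 := hV.orient p b c (hpa.trans hab) hbc hc
  have o4 := hV.orient p a b hpa hab (hbc.le.trans hc)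
  have key : cross (V p - V p + (V b - V a)) (V c - V a) * cross u (V b - V p) +
      cross (V a - V p) (V b - V p) * cross u (V c - V b) =
      cross (V b - V p) (V c - V p) * cross u (V b - V a) := by
    simp only [cross, Complex.sub_re, Complex.sub_im, Complex.add_re, Complex.add_im]; ring
  rw [sub_self, zero_add] at key
  have : 0 ≤ cross (V b - V p) (V c - V p) * cross u (V b - V a) := by
    rw [← key]; positivity
  exact nonneg_of_mul_nonneg_right this o3

/-- The counterpart of `cross_mono` for values that decrease from `p` to `a`. -/
theorem cross_mono' (hV : ConvexChain V D) (u : ℂ) {p a b c : ℕ} (hpa : p < a) (hab : a < b)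
    (hbc : b < c) (hc : c ≤ D) (h1 : 0 ≤ cross (V c - V a) u) (h2 : 0 ≤ cross (V a - V p) u) :
    0 ≤ cross (V b - V a) u := by
  have o1 := hV.orient a b c hab hbc hc
  have o2 := hV.orient p a c hpa (hab.trans hbc) hc
  have o3 := hV.orient p b c (hpa.trans hab) hbc hc
  have o4 := hV.orient p a b hpa hab (hbc.le.trans hc)
  have key : cross (V b - V a) (V c - V a) * cross (V a - V p) u +
      cross (V a - V p) (V b - V p) * cross (V c - V a) u =
      cross (V a - V p) (V c - V p) * cross (V b - V a) u := by
    simp only [cross, Complex.sub_re, Complex.sub_im]; ring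
  have : 0 ≤ cross (V a - V p) (V c - V p) * cross (V b - V a) u := by
    rw [← key]; positivity
  exact nonneg_of_mul_nonneg_right this o2

theorem ne (hV : ConvexChain V D) {a b : ℕ} (hab : a < b) (hb : b ≤ D) : V b - V a ≠ 0 := by
  intro h
  have := hV.three_le
  rcases hb.lt_or_eq with h1 | h1
  · have := hV.orient a b D hab h1 le_rfl
    rw [h] at this
    simp [cross] at this
  · rcases Nat.eq_zero_or_pos a with h2 | h2
    · have := hV.orient a 1 b (by omega) (by omega) hb
      rw [h] at this
      simp [cross] at this
    · have := hV.orient 0 a b h2 hab hb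
      rw [sub_eq_zero.1 h] at this
      simp [cross, mul_comm] at this

theorem first_ne (hV : ConvexChain V D) : V 1 - V 0 ≠ 0 :=
  hV.ne one_pos (by have := hV.three_le; omega)

theorem cross_first_last (hV : ConvexChain V D) : 0 ≤ cross (V 1 - V 0) (V D - V (D - 1)) := by
  rw [cross_div hV.first_ne, div_self hV.first_ne, cross_eq, Complex.arg_one, sub_zero]
  have := Real.sin_nonneg_of_nonneg_of_le_pi hV.arg_nonneg
    (by linarith [hV.arg_le, Real.pi_pos])
  exact mul_nonneg (Complex.normSq_nonneg _) (mul_nonneg (by positivity) this)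

theorem cross_first_nonneg (hV : ConvexChain V D) {a b : ℕ} (hab : a < b) (hb : b ≤ D) :
    0 ≤ cross (V 1 - V 0) (V b - V a) := by
  have h3 := hV.three_le
  -- the height of a point above the line of the first edge
  have h0 : ∀ b ≤ D, 0 ≤ cross (V 1 - V 0) (V b - V 0) := by
    intro b hb
    rcases lt_trichotomy b 1 with h | h | h
    · obtain rfl : b = 0 := by omega
      simp [cross]
    · subst h; simp [cross, mul_comm]
    · exact (hV.orient 0 1 b one_pos h hb).le
  have h1 : ∀ b < D, 0 ≤ cross (V 1 - V 0) (V D - V b) := by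
    intro b hb
    rcases lt_or_eq_of_le (Nat.le_sub_one_of_lt hb) with h | h
    · have h2 : 0 ≤ cross (V 1 - V 0) (V (D - 1) - V b) := by
        rcases Nat.eq_zero_or_pos b with h' | h'
        · rw [h']; exact h0 _ (by omega)
        · exact hV.cross_mono _ h' h (by omega) le_rfl (h0 _ (by omega)) hV.cross_first_last
      have h4 := hV.cross_first_last
      have : cross (V 1 - V 0) (V D - V b) = cross (V 1 - V 0) (V (D - 1) - V b) +
          cross (V 1 - V 0) (V D - V (D - 1)) := by
        simp only [cross, Complex.sub_re, Complex.sub_im]; ring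
      linarith
    · rw [h]; exact hV.cross_first_last
  rcases Nat.eq_zero_or_pos a with h | h
  · rw [h]; exact h0 b hb
  · rcases hb.lt_or_eq with h' | h'
    · exact hV.cross_mono _ h hab h' le_rfl (h0 _ hb) (h1 _ h')
    · rw [h']; exact h1 a (by omega)

theorem cross_last_nonneg (hV : ConvexChain V D) {a b : ℕ} (hab : a < b) (hb : b ≤ D) :
    0 ≤ cross (V b - V a) (V D - V (D - 1)) := by
  have h3 := hV.three_le
  have h0 : ∀ a ≤ D, 0 ≤ cross (V D - V a) (V D - V (D - 1)) := by
    intro a ha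
    rcases lt_trichotomy a (D - 1) with h | h | h
    · have := hV.orient a (D - 1) D h (by omega) le_rfl
      have e : cross (V D - V a) (V D - V (D - 1)) = cross (V (D - 1) - V a) (V D - V a) := by
        simp only [cross, Complex.sub_re, Complex.sub_im]; ring
      rw [e]; exact this.le
    · rw [h]; simp [cross, mul_comm]
    · obtain rfl : a = D := by omega
      simp [cross]
  have h1 : ∀ b, 0 < b → b ≤ D → 0 ≤ cross (V b - V 0) (V D - V (D - 1)) := by
    intro b hb hbD
    rcases lt_or_eq_of_le (Nat.succ_le_of_lt hb) with h | h
    · rcases hbD.lt_or_eq with h' | h'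
      · have h2 := hV.cross_mono' (V D - V (D - 1)) one_pos h h' le_rfl (h0 _ (by omega))
          hV.cross_first_last
        have h4 := hV.cross_first_last
        have : cross (V b - V 0) (V D - V (D - 1)) = cross (V 1 - V 0) (V D - V (D - 1)) +
            cross (V b - V 1) (V D - V (D - 1)) := by
          simp only [cross, Complex.sub_re, Complex.sub_im]; ring
        linarith
      · rw [h']; exact h0 _ (by omega)
    · rw [← h]; exact hV.cross_first_last
  rcases Nat.eq_zero_or_pos a with h | h
  · rw [h]; exact h1 b (by omega) hb
  · rcases hb.lt_or_eq with h' | h'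
    · exact hV.cross_mono' _ h hab h' le_rfl (h0 _ (by omega)) (h1 _ h (by omega))
    · rw [h']; exact h0 a (by omega)

theorem div_ne (hV : ConvexChain V D) {a b : ℕ} (hab : a < b) (hb : b ≤ D) :
    (V b - V a) / (V 1 - V 0) ≠ 0 :=
  div_ne_zero (hV.ne hab hb) hV.first_ne

theorem sin_pos_of_cross_pos {a b : ℂ} (h : 0 < cross a b) :
    0 < Real.sin (Complex.arg b - Complex.arg a) := by
  rw [cross_eq] at h
  exact pos_of_mul_pos_right h (by positivity)

theorem normSq_first_pos (hV : ConvexChain V D) : 0 < Complex.normSq (V 1 - V 0) :=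
  Complex.normSq_pos.2 hV.first_ne

theorem dir_nonneg (hV : ConvexChain V D) {a b : ℕ} (hab : a < b) (hb : b ≤ D) : 0 ≤ dir V a b := by
  rw [dir, Complex.arg_nonneg_iff]
  have h := hV.cross_first_nonneg hab hb
  rw [cross_div hV.first_ne, div_self hV.first_ne] at h
  have := nonneg_of_mul_nonneg_right h hV.normSq_first_pos
  simpa [cross] using this

theorem dir_le (hV : ConvexChain V D) {a b : ℕ} (hab : a < b) (hb : b ≤ D) :
    dir V a b ≤ 2 * Real.pi / 3 := by
  refine le_trans ?_ hV.arg_le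
  have h3 := hV.three_le
  have h := hV.cross_last_nonneg hab hb
  rw [cross_div hV.first_ne, cross_eq] at h
  have h1 : 0 < ‖(V b - V a) / (V 1 - V 0)‖ := norm_pos_iff.2 (hV.div_ne hab hb)
  have h2 : 0 < ‖(V D - V (D - 1)) / (V 1 - V 0)‖ :=
    norm_pos_iff.2 (hV.div_ne (by omega) le_rfl)
  have h4 := nonneg_of_mul_nonneg_right (nonneg_of_mul_nonneg_right h hV.normSq_first_pos)
    (mul_pos h1 h2)
  have h5 := hV.dir_nonneg hab hb
  have h6 := Complex.arg_le_pi ((V b - V a) / (V 1 - V 0))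
  have h7 := hV.arg_nonneg
  have h8 := hV.arg_le
  rw [dir] at *
  by_contra hcon
  push Not at hcon
  rcases h6.lt_or_eq with h9 | h9
  · have := Real.sin_neg_of_neg_of_neg_pi_lt (sub_neg.2 hcon) (by linarith)
    linarith
  · -- the chord is opposite to the first edge, so the last edge is parallel to the first one
    rcases h7.lt_or_eq with h10 | h10
    · have := Real.sin_neg_of_neg_of_neg_pi_lt (sub_neg.2 hcon) (by linarith)
      linarith
    · have h11 : cross (V 1 - V 0) (V D - V (D - 1)) = 0 := by
        rw [cross_div hV.first_ne, div_self hV.first_ne, cross_eq, Complex.arg_one, ← h10]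
        simp
      have h12 := hV.cross_first_nonneg (a := 1) (b := D - 1) (by omega) (by omega)
      have h13 := hV.orient 0 1 (D - 1) one_pos (by omega) (by omega)
      have h14 := hV.cross_last_nonneg (a := 0) (b := D - 1) (by omega) (by omega)
      -- the last edge is a positive multiple of the first one
      have h15 : (V D - V (D - 1)) / (V 1 - V 0) = (‖(V D - V (D - 1)) / (V 1 - V 0)‖ : ℝ) := by
        conv_lhs => rw [← Complex.norm_mul_exp_arg_mul_I ((V D - V (D - 1)) / (V 1 - V 0)), ← h10]
        simp
      have h16 : V D - V (D - 1) = (‖(V D - V (D - 1)) / (V 1 - V 0)‖ : ℝ) * (V 1 - V 0) := by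
        rw [← h15, div_mul_cancel₀ _ hV.first_ne]
      have h17 : cross (V (D - 1) - V 0) (V D - V (D - 1)) =
          -‖(V D - V (D - 1)) / (V 1 - V 0)‖ * cross (V 1 - V 0) (V (D - 1) - V 0) := by
        conv_lhs => rw [h16]
        simp only [cross, Complex.re_ofReal_mul, Complex.im_ofReal_mul]
        ring
      nlinarith [mul_pos h2 h13]

theorem sub_dir_pos (hV : ConvexChain V D) {a b c d : ℕ} (hab : a < b) (hb : b ≤ D) (hcd : c < d)
    (hd : d ≤ D) (h : 0 < cross (V b - V a) (V d - V c)) : dir V a b < dir V c d := by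
  rw [cross_div hV.first_ne] at h
  have h1 := sin_pos_of_cross_pos (pos_of_mul_pos_right h hV.normSq_first_pos.le)
  have h2 := hV.dir_nonneg hab hb
  have h3 := hV.dir_le hab hb
  have h4 := hV.dir_nonneg hcd hd
  have h5 := hV.dir_le hcd hd
  rw [dir, dir] at *
  by_contra hcon
  have := Real.sin_nonpos_of_nonpos_of_neg_pi_le
    (x := Complex.arg ((V d - V c) / (V 1 - V 0)) - Complex.arg ((V b - V a) / (V 1 - V 0)))
    (by linarith) (by linarith [Real.pi_pos])
  linarith

theorem dir_lt_left (hV : ConvexChain V D) {a b c : ℕ} (hab : a < b) (hbc : b < c) (hc : c ≤ D) :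
    dir V a b < dir V a c :=
  hV.sub_dir_pos hab (hbc.le.trans hc) (hab.trans hbc) hc (hV.orient a b c hab hbc hc)

theorem dir_lt_right (hV : ConvexChain V D) {a b c : ℕ} (hab : a < b) (hbc : b < c) (hc : c ≤ D) :
    dir V a c < dir V b c := by
  refine hV.sub_dir_pos (hab.trans hbc) hc hbc hc ?_
  have h := hV.orient a b c hab hbc hc
  have e : cross (V c - V a) (V c - V b) = cross (V b - V a) (V c - V a) := by
    simp only [cross, Complex.sub_re, Complex.sub_im]; ring
  rwa [e]

theorem dist_eq (hV : ConvexChain V D) (a b : ℕ) :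
    dist (V a) (V b) = ‖V 1 - V 0‖ * ‖(V b - V a) / (V 1 - V 0)‖ := by
  have := norm_pos_iff.2 hV.first_ne
  rw [norm_div, dist_comm, dist_eq_norm]
  field_simp

theorem div_add (a b c : ℕ) : (V b - V a) / (V 1 - V 0) + (V c - V b) / (V 1 - V 0) =
    (V c - V a) / (V 1 - V 0) := by
  rw [← add_div]; congr 1; ring

/-- In a triangle `a, b, c` of the chain, the angle at `b` is at least `π/3`. If the angle at `a` is
at most `π/3`, then the side opposite to it is the shorter one. -/
theorem dist_le_of_left (hV : ConvexChain V D) {a b c : ℕ} (hab : a < b) (hbc : b < c) (hc : c ≤ D)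
    (h : dir V a c - dir V a b ≤ Real.pi / 3) : dist (V b) (V c) ≤ dist (V a) (V c) := by
  rw [hV.dist_eq, hV.dist_eq, ← div_add a b c]
  refine mul_le_mul_of_nonneg_left ?_ (norm_nonneg _)
  have h1 := hV.dir_lt_left hab hbc hc
  have h2 := hV.dir_lt_right hab hbc hc
  have h3 := hV.dir_nonneg hab (hbc.le.trans hc)
  have h4 := hV.dir_le hbc hc
  unfold dir at *
  rw [← div_add a b c] at h h1 h2
  have h5 := sub_cross_nonneg (sub_nonneg.2 h1.le) h
  have h6 := add_cross_nonneg (sub_nonneg.2 (h1.trans h2).le) (by linarith)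
  rw [cross_self_add] at h5
  have h7 : 0 < √3 := by positivity
  exact norm_le_norm_add_of_dot (by nlinarith)

theorem dist_lt_of_left (hV : ConvexChain V D) {a b c : ℕ} (hab : a < b) (hbc : b < c) (hc : c ≤ D)
    (h : dir V a c - dir V a b < Real.pi / 3) : dist (V b) (V c) < dist (V a) (V c) := by
  rw [hV.dist_eq, hV.dist_eq]
  refine mul_lt_mul_of_pos_left ?_ (norm_pos_iff.2 hV.first_ne)
  have h1 := hV.dir_lt_left hab hbc hc
  have h2 := hV.dir_lt_right hab hbc hc
  have h3 := hV.dir_nonneg hab (hbc.le.trans hc)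
  have h4 := hV.dir_le hbc hc
  unfold dir at *
  have h5 := sub_cross_pos (hV.div_ne hab (hbc.le.trans hc)) (hV.div_ne (hab.trans hbc) hc)
    (sub_nonneg.2 h1.le) h
  have h6 := add_cross_nonneg (sub_nonneg.2 (h1.trans h2).le) (by linarith)
  rw [← div_add a b c] at h5 ⊢
  rw [cross_self_add] at h5
  have h7 : 0 < √3 := by positivity
  exact norm_lt_norm_add_of_dot (by nlinarith)

theorem dist_le_of_right (hV : ConvexChain V D) {a b c : ℕ} (hab : a < b) (hbc : b < c) (hc : c ≤ D)
    (h : dir V b c - dir V a c ≤ Real.pi / 3) : dist (V a) (V b) ≤ dist (V a) (V c) := by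
  rw [hV.dist_eq, hV.dist_eq, ← div_add a b c]
  refine mul_le_mul_of_nonneg_left ?_ (norm_nonneg _)
  have h1 := hV.dir_lt_left hab hbc hc
  have h2 := hV.dir_lt_right hab hbc hc
  have h3 := hV.dir_nonneg hab (hbc.le.trans hc)
  have h4 := hV.dir_le hbc hc
  unfold dir at *
  rw [← div_add a b c] at h h1 h2
  have h5 := sub_cross_nonneg (sub_nonneg.2 h2.le) h
  have h6 := add_cross_nonneg (sub_nonneg.2 (h1.trans h2).le) (by linarith)
  rw [cross_add_self] at h5
  have h7 : 0 < √3 := by positivity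
  rw [add_comm]
  refine norm_le_norm_add_of_dot ?_
  rw [dot_comm, add_comm ((V c - V b) / (V 1 - V 0)), dot_comm ((V c - V b) / (V 1 - V 0))]
  nlinarith

theorem dist_lt_of_right (hV : ConvexChain V D) {a b c : ℕ} (hab : a < b) (hbc : b < c) (hc : c ≤ D)
    (h : dir V b c - dir V a c < Real.pi / 3) : dist (V a) (V b) < dist (V a) (V c) := by
  rw [hV.dist_eq, hV.dist_eq]
  refine mul_lt_mul_of_pos_left ?_ (norm_pos_iff.2 hV.first_ne)
  have h1 := hV.dir_lt_left hab hbc hc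
  have h2 := hV.dir_lt_right hab hbc hc
  have h3 := hV.dir_nonneg hab (hbc.le.trans hc)
  have h4 := hV.dir_le hbc hc
  unfold dir at *
  have h5 := sub_cross_pos (hV.div_ne (hab.trans hbc) hc) (hV.div_ne hbc hc)
    (sub_nonneg.2 h2.le) h
  have h6 := add_cross_nonneg (sub_nonneg.2 (h1.trans h2).le) (by linarith)
  rw [← div_add a b c] at h5 ⊢
  rw [cross_add_self] at h5
  have h7 : 0 < √3 := by positivity
  rw [add_comm]
  refine norm_lt_norm_add_of_dot ?_
  rw [dot_comm, add_comm ((V c - V b) / (V 1 - V 0)), dot_comm ((V c - V b) / (V 1 - V 0))]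
  nlinarith

end ConvexChain

/-! ### Rematching along a chain -/

section

open Real

variable {V : ℕ → ℂ} {s : ℕ → ℤ} {D : ℕ} {f : ℕ → ℕ}

/-- The matching `g` does not join `0` and `D`, all of its pairs except those across the cut `C`
consist of consecutive positions of a level, and no pair of `g` is longer than all pairs of `f`. -/
structure IsRematching (V : ℕ → ℂ) (s : ℕ → ℤ) (D : ℕ) (f : ℕ → ℕ) (C : ℕ) (g : ℕ → ℕ) : Prop where
  isNoncrossing : IsNoncrossing s D g
  ne : g 0 ≠ D
  tight : ∀ a ≤ D, a < g a → (a < C ↔ g a < C) → ∀ b, a < b → b < g a → level s b ≠ level s a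
  short : ∀ a ≤ D, a < g a → ∃ b ≤ D, dist (V a) (V (g a)) ≤ dist (V b) (V (f b))

/-- Suppose that some chord from `V 0` makes an angle of more than `π/3` with the chord from `V 0`
to `V D`. The points with this property form an initial part of the chain, and behind it the chain
runs in directions close to the last edge. So only pairs from the initial part to the rest can be
longer than `V 0 V D`, and such a pair gets longer if its right end moves on. -/
theorem ConvexChain.exists_isRematching_of_left (hV : ConvexChain V D) (hs : IsSign s)
    (hf : IsNoncrossing s D f) (hf0 : f 0 = D) {k p : ℕ} (hk0 : 0 < k) (hkD : k < D)
    (hk : π / 3 < dir V 0 D - dir V 0 k) (hp0 : 0 < p) (hpD : p < D)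
    (hpl : level s p = level s 0) (hp : dir V 0 D - dir V 0 p ≤ π / 3) :
    ∃ C g, IsRematching V s D f C g := by
  obtain ⟨C, hC1, hC2, hC3, hC4⟩ :=
    exists_first (p := fun k => dir V 0 D - dir V 0 k ≤ π / 3) (a := 1) (y := D + 1)
      ⟨p, hp0, by omega, hp⟩
  have hmono : ∀ a b, 0 < a → a ≤ b → b ≤ D → dir V 0 a ≤ dir V 0 b := by
    intro a b ha hab hb
    rcases hab.lt_or_eq with h | h
    · exact (hV.dir_lt_left ha h hb).le
    · rw [h]
  have hL : ∀ a, C ≤ a → a ≤ D → dir V 0 D - dir V 0 a ≤ π / 3 := fun a h h' => by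
    have := hmono C a (by omega) h h'
    linarith
  have hK : ∀ a, 0 < a → a < C → π / 3 < dir V 0 D - dir V 0 a := fun a h h' => by
    have := hC4 a h h'
    push Not at this
    exact this
  have hCp : C ≤ p := by
    by_contra h
    have := hK p hp0 (by omega)
    linarith
  have hα : π / 3 < dir V 0 D := by
    have := hV.dir_nonneg hk0 hkD.le
    linarith
  obtain ⟨g, hg, h1, h2⟩ := exists_straightened hs hf (C := C) (by omega)
  refine ⟨C, g, hg, ?_, h1, ?_⟩
  · intro h
    exact (h2 0 (by omega) (by omega)).2 p hCp (by omega) hpl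
  · have hzero : ∀ l, 0 < l → l ≤ D → dist (V 0) (V l) ≤ dist (V 0) (V D) := by
      intro l hl hlD
      rcases hlD.lt_or_eq with h | h
      · refine hV.dist_le_of_right hl h le_rfl ?_
        have := hV.dir_le h le_rfl
        linarith
      · rw [h]
    have hnear : ∀ a b, a < b → b ≤ D → (0 < a → dir V 0 b - dir V 0 a ≤ π / 3) →
        ∃ c ≤ D, dist (V a) (V b) ≤ dist (V c) (V (f c)) := by
      intro a b hab hb h
      refine ⟨0, by omega, ?_⟩
      rw [hf0]
      rcases Nat.eq_zero_or_pos a with h' | h'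
      · rw [h']; exact hzero b (by omega) hb
      · exact (hV.dist_le_of_left h' hab hb (h h')).trans (hzero b (by omega) hb)
    intro a ha hag
    have hgD := hg.le a ha
    rcases Nat.eq_zero_or_pos a with ha0 | ha0
    · exact hnear a _ hag hgD (by omega)
    rcases lt_or_ge a C with haC | haC
    · rcases lt_or_ge (g a) C with hgC | hgC
      · refine hnear a _ hag hgD fun _ => ?_
        have e1 := hK (g a) (by omega) hgC
        have e2 := hV.dir_nonneg ha0 ha
        have e3 := hV.dir_le (a := 0) (b := D) (by omega) le_rfl
        linarith
      · by_cases hd : dir V 0 (g a) - dir V 0 a ≤ π / 3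
        · exact hnear a _ hag hgD fun _ => hd
        · refine ⟨a, ha, ?_⟩
          rcases (h2 a haC hgC).1.lt_or_eq with h | h
          · have hfD := hf.le a ha
            refine hV.dist_le_of_right hag h hfD ?_
            have e1 := hV.dir_nonneg ha0 ha
            have e2 := hV.dir_le h hfD
            have e3 := hV.dir_lt_left (a := 0) (by omega) h hfD
            have e4 := hV.dir_lt_right ha0 (hag.trans h) hfD
            linarith
          · rw [h]
    · refine hnear a _ hag hgD fun _ => ?_
      have e1 := hL a haC ha
      have e2 := hmono (g a) D (by omega) hgD le_rfl
      linarith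

/-- The mirror image of `ConvexChain.exists_isRematching_of_left`. -/
theorem ConvexChain.exists_isRematching_of_right (hV : ConvexChain V D) (hs : IsSign s)
    (hf : IsNoncrossing s D f) (hf0 : f 0 = D) {k p : ℕ} (hk0 : 0 < k) (hkD : k < D)
    (hk : π / 3 < dir V k D - dir V 0 D) (hp0 : 0 < p) (hpD : p < D)
    (hpl : level s p = level s 0) (hp : dir V p D - dir V 0 D ≤ π / 3) :
    ∃ C g, IsRematching V s D f C g := by
  obtain ⟨C, hC1, hC2, hC3, hC4⟩ :=
    exists_first (p := fun k => k = D ∨ π / 3 < dir V k D - dir V 0 D) (a := 1) (y := D + 1)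
      ⟨k, hk0, by omega, Or.inr hk⟩
  have hmono : ∀ a b, a ≤ b → b < D → dir V a D ≤ dir V b D := by
    intro a b hab hb
    rcases hab.lt_or_eq with h | h
    · exact (hV.dir_lt_right h hb le_rfl).le
    · rw [h]
  have hR : ∀ a, C ≤ a → a < D → π / 3 < dir V a D - dir V 0 D := fun a h h' => by
    have := hmono C a h h'
    rcases hC3 with h'' | h''
    · omega
    · linarith
  have hL : ∀ a, a < C → dir V a D - dir V 0 D ≤ π / 3 := fun a h => by
    rcases Nat.eq_zero_or_pos a with h' | h'
    · rw [h', sub_self]; positivity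
    · have := hC4 a h' h
      push Not at this
      exact this.2
  have hCp : p < C := by
    by_contra h
    have := hR p (by omega) hpD
    linarith
  have hα : dir V 0 D < π / 3 := by
    have := hV.dir_le hkD le_rfl
    linarith
  obtain ⟨g, hg, h1, h2⟩ := exists_straightened_left hs hf (C := C) (by omega)
  refine ⟨C, g, hg, ?_, h1, ?_⟩
  · intro h
    exact (h2 0 (by omega) (by omega)).2 p hp0 hCp hpl
  · have hend : ∀ l < D, dist (V l) (V D) ≤ dist (V 0) (V D) := by
      intro l hl
      rcases Nat.eq_zero_or_pos l with h | h
      · rw [h]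
      · refine hV.dist_le_of_left h hl le_rfl ?_
        have := hV.dir_nonneg h hl.le
        linarith
    have hnear : ∀ a b, a < b → b ≤ D → (b < D → dir V b D - dir V a D ≤ π / 3) →
        ∃ c ≤ D, dist (V a) (V b) ≤ dist (V c) (V (f c)) := by
      intro a b hab hb h
      refine ⟨0, by omega, ?_⟩
      rw [hf0]
      rcases hb.lt_or_eq with h' | h'
      · exact (hV.dist_le_of_right hab h' le_rfl (h h')).trans (hend a (by omega))
      · rw [h']; exact hend a (by omega)
    intro a ha hag
    have hgD := hg.le a ha
    rcases hgD.lt_or_eq with hgD' | hgD'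
    swap
    · exact hnear a _ hag hgD (by omega)
    rcases lt_or_ge (g a) C with hgC | hgC
    · refine hnear a _ hag hgD fun _ => ?_
      have e1 := hL (g a) hgC
      have e2 := hmono 0 a (by omega) (by omega)
      linarith
    · rcases lt_or_ge a C with haC | haC
      · by_cases hd : dir V (g a) D - dir V a D ≤ π / 3
        · exact hnear a _ hag hgD fun _ => hd
        · refine ⟨g a, hgD, ?_⟩
          rw [dist_comm (V (g a))]
          rcases (h2 a haC hgC).1.lt_or_eq with h | h
          · refine hV.dist_le_of_left h hag hgD ?_
            have e1 := hV.dir_nonneg h ha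
            have e2 := hV.dir_le hgD' le_rfl
            have e3 := hV.dir_lt_left (h.trans hag) hgD' le_rfl
            have e4 := hV.dir_lt_right h (hag.trans hgD') le_rfl
            linarith
          · rw [h]
      · refine hnear a _ hag hgD fun _ => ?_
        have e1 := hR a haC (by omega)
        have e2 := hV.dir_le hgD' le_rfl
        have e3 := hV.dir_nonneg (a := 0) (b := D) (by omega) le_rfl
        linarith

/-- If `f` joins the ends of a chain, then it can be replaced by a matching that does not, unless
all points of the chain on the level of its ends see large angles at the same end. -/
theorem ConvexChain.exists_isRematching (hV : ConvexChain V D) (hs : IsSign s)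
    (hf : IsNoncrossing s D f) (hf0 : f 0 = D) (hin : ∃ p, 0 < p ∧ p < D ∧ level s p = level s 0) :
    (∃ C g, IsRematching V s D f C g) ∨
    (∀ p, 0 < p → p < D → level s p = level s 0 → π / 3 < dir V 0 D - dir V 0 p) ∨
    (∀ p, 0 < p → p < D → level s p = level s 0 → π / 3 < dir V p D - dir V 0 D) := by
  by_cases hl : ∃ k, 0 < k ∧ k < D ∧ π / 3 < dir V 0 D - dir V 0 k
  · obtain ⟨k, hk0, hkD, hk⟩ := hl
    by_cases h : ∃ p, 0 < p ∧ p < D ∧ level s p = level s 0 ∧ dir V 0 D - dir V 0 p ≤ π / 3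
    · obtain ⟨p, hp0, hpD, hpl, hp⟩ := h
      exact Or.inl (hV.exists_isRematching_of_left hs hf hf0 hk0 hkD hk hp0 hpD hpl hp)
    · push Not at h
      exact Or.inr (Or.inl h)
  by_cases hr : ∃ k, 0 < k ∧ k < D ∧ π / 3 < dir V k D - dir V 0 D
  · obtain ⟨k, hk0, hkD, hk⟩ := hr
    by_cases h : ∃ p, 0 < p ∧ p < D ∧ level s p = level s 0 ∧ dir V p D - dir V 0 D ≤ π / 3
    · obtain ⟨p, hp0, hpD, hpl, hp⟩ := h
      exact Or.inl (hV.exists_isRematching_of_right hs hf hf0 hk0 hkD hk hp0 hpD hpl hp)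
    · push Not at h
      exact Or.inr (Or.inr h)
  -- otherwise no chord of the chain is longer than `V 0 V D`
  push Not at hl hr
  left
  obtain ⟨g, hg, h1⟩ := exists_tight hs (hf.height_end hs)
  refine ⟨D + 1, g, hg, ?_, fun a ha hag _ => h1 a ha hag, ?_⟩
  · intro h
    obtain ⟨p, hp0, hpD, hpl⟩ := hin
    exact h1 0 (by omega) (by omega) p hp0 (by omega) hpl
  · intro a ha hag
    have hgD := hg.le a ha
    refine ⟨0, by omega, ?_⟩
    rw [hf0]
    have e1 : dist (V a) (V (g a)) ≤ dist (V 0) (V (g a)) := by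
      rcases Nat.eq_zero_or_pos a with h | h
      · rw [h]
      · refine hV.dist_le_of_left h hag hgD ?_
        have := hl a h (by omega)
        rcases hgD.lt_or_eq with h' | h'
        · have := hV.dir_lt_left (a := 0) (by omega) h' le_rfl
          linarith
        · rw [h']; exact this
    refine e1.trans ?_
    rcases hgD.lt_or_eq with h' | h'
    · exact hV.dist_le_of_right (by omega) h' le_rfl (hr _ (by omega) h')
    · rw [h']

end

/-! ### Positions on the polygon -/

variable {n : ℕ}

theorem val_natCast_sub [NeZero (2 * n)] {a c : ℕ} (ha : a < 2 * n) (hc : c < 2 * n) :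
    ((c : ZMod (2 * n)) - a).val = if a ≤ c then c - a else c + 2 * n - a := by
  split_ifs with h
  · rw [← Nat.cast_sub h, ZMod.val_natCast, Nat.mod_eq_of_lt (by omega)]
  · have : (c : ZMod (2 * n)) - a = ((c + 2 * n - a : ℕ) : ZMod (2 * n)) := by
      rw [Nat.cast_sub (by omega), Nat.cast_add, ZMod.natCast_self, add_zero]
    rw [this, ZMod.val_natCast, Nat.mod_eq_of_lt (by omega)]

theorem mem_arc_of_le [NeZero (2 * n)] (i : ZMod (2 * n)) {a b c : ℕ} (hab : a ≤ b)
    (hb : b < 2 * n) (hc : c < 2 * n) :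
    i + (c : ZMod (2 * n)) ∈ arc (i + (a : ZMod (2 * n))) (i + b) ↔ a ≤ c ∧ c ≤ b := by
  simp only [arc, Set.mem_ofPred_eq, add_sub_add_left_eq_sub]
  rw [val_natCast_sub (by omega) hc, val_natCast_sub (by omega) hb]
  split_ifs <;> omega

theorem mem_arc_of_lt [NeZero (2 * n)] (i : ZMod (2 * n)) {a b c : ℕ} (hba : b < a)
    (ha : a < 2 * n) (hc : c < 2 * n) :
    i + (c : ZMod (2 * n)) ∈ arc (i + (a : ZMod (2 * n))) (i + b) ↔ a ≤ c ∨ c ≤ b := by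
  simp only [arc, Set.mem_ofPred_eq, add_sub_add_left_eq_sub]
  rw [val_natCast_sub (by omega) hc, val_natCast_sub (by omega) (by omega)]
  split_ifs <;> omega

theorem add_natCast_inj [NeZero (2 * n)] {i : ZMod (2 * n)} {a b : ℕ} (ha : a < 2 * n)
    (hb : b < 2 * n) (h : i + (a : ZMod (2 * n)) = i + b) : a = b := by
  have h1 := congrArg ZMod.val (add_left_cancel h)
  rwa [ZMod.val_natCast_of_lt ha, ZMod.val_natCast_of_lt hb] at h1

theorem exists_eq_add [NeZero (2 * n)] (i x : ZMod (2 * n)) :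
    ∃ a : ℕ, a < 2 * n ∧ x = i + a :=
  ⟨(x - i).val, ZMod.val_lt _, by rw [ZMod.natCast_zmod_val]; ring⟩

theorem exists_of_mem_arc [NeZero (2 * n)] {i : ZMod (2 * n)} {D : ℕ} (hD : D < 2 * n)
    {x : ZMod (2 * n)} (hx : x ∈ arc i (i + D)) : ∃ a : ℕ, a ≤ D ∧ x = i + a := by
  obtain ⟨a, ha, rfl⟩ := exists_eq_add i x
  have := (mem_arc_of_le i (a := 0) (b := D) (by omega) hD ha).1 (by simpa using hx)
  exact ⟨a, this.2, rfl⟩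

theorem add_mem_arc [NeZero (2 * n)] (i : ZMod (2 * n)) {D a : ℕ} (hD : D < 2 * n) (ha : a ≤ D) :
    i + (a : ZMod (2 * n)) ∈ arc i (i + D) := by
  have := (mem_arc_of_le i (a := 0) (b := D) (c := a) (by omega) hD (by omega)).2 (by omega)
  simpa using this

theorem arc_eq_univ [NeZero (2 * n)] (i : ZMod (2 * n)) :
    arc i (i + (2 * n - 1 : ℕ)) = Set.univ := by
  have := NeZero.pos (2 * n)
  refine Set.eq_univ_of_forall fun x => ?_
  obtain ⟨a, ha, rfl⟩ := exists_eq_add i x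
  exact add_mem_arc i (by omega) (by omega)

variable (P : BicoloredPolygon n)

/-! ### Colours as signs -/

open Classical in
/-- The colours of the points as one walks from `i` in the positive direction: `1` for red and
`-1` for blue. -/
noncomputable def colorSign (i : ZMod (2 * n)) (a : ℕ) : ℤ :=
  if i + (a : ZMod (2 * n)) ∈ P.red then 1 else -1

theorem isSign_colorSign (i : ZMod (2 * n)) : IsSign (P.colorSign i) := by
  intro a
  unfold colorSign
  split_ifs <;> simp

theorem colorSign_eq_neg {i : ZMod (2 * n)} {a b : ℕ} :
    P.colorSign i b = -P.colorSign i a ↔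
      (i + (a : ZMod (2 * n)) ∈ P.red ↔ i + (b : ZMod (2 * n)) ∉ P.red) := by
  unfold colorSign
  split_ifs <;> simp_all

theorem colorSign_add (i : ZMod (2 * n)) (x a : ℕ) :
    P.colorSign (i + x) a = P.colorSign i (x + a) := by
  have h : i + (x : ZMod (2 * n)) + a = i + ((x + a : ℕ) : ZMod (2 * n)) := by
    rw [Nat.cast_add, add_assoc]
  unfold colorSign
  rw [h]

theorem height_add (i : ZMod (2 * n)) (x a : ℕ) :
    height (P.colorSign (i + x)) a = height (P.colorSign i) (x + a) - height (P.colorSign i) x := by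
  simp only [height, Finset.sum_range_add, colorSign_add]; ring

theorem level_add (i : ZMod (2 * n)) (x a : ℕ) :
    level (P.colorSign (i + x)) a =
      level (P.colorSign i) (x + a) - 2 * height (P.colorSign i) x := by
  simp only [level, height_add, add_assoc]; ring

theorem height_eq_sub [NeZero (2 * n)] (i : ZMod (2 * n)) {D : ℕ} (hD : D < 2 * n) :
    height (P.colorSign i) (D + 1) = ((arc i (i + D) ∩ P.red).ncard : ℤ) -
      ((arc i (i + D) \ P.red).ncard : ℤ) := by
  classical
  have hinj : Set.InjOn (fun a : ℕ => i + (a : ZMod (2 * n))) (Finset.range (D + 1)) := by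
    intro a ha b hb h
    simp only [Finset.coe_range, Set.mem_Iio] at ha hb
    exact add_natCast_inj (by omega) (by omega) h
  have h1 : ∀ T : Set (ZMod (2 * n)), (arc i (i + D) ∩ T).ncard =
      ((Finset.range (D + 1)).filter (fun a : ℕ => i + (a : ZMod (2 * n)) ∈ T)).card := by
    intro T
    rw [← Finset.card_image_of_injOn (hinj.mono (Finset.coe_subset.2 (Finset.filter_subset _ _))),
      ← Set.ncard_coe_finset]
    congr 1
    ext x
    simp only [Set.mem_inter_iff, Finset.coe_image, Finset.coe_filter, Finset.mem_range,
      Set.mem_image, Set.mem_ofPred_eq]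
    constructor
    · rintro ⟨hx, hT⟩
      obtain ⟨a, ha, rfl⟩ := exists_of_mem_arc hD hx
      exact ⟨a, ⟨by omega, hT⟩, rfl⟩
    · rintro ⟨a, ⟨ha, hT⟩, rfl⟩
      exact ⟨add_mem_arc i hD (by omega), hT⟩
  rw [Set.sdiff_eq, h1, h1]
  simp only [height, colorSign, Set.mem_compl_iff]
  rw [Finset.sum_ite]
  simp [sub_eq_add_neg]

theorem height_eq_zero_of_balanced [NeZero (2 * n)] {i : ZMod (2 * n)} {D : ℕ} (hD : D < 2 * n)
    (h : P.Balanced (arc i (i + D))) : height (P.colorSign i) (D + 1) = 0 := by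
  rw [P.height_eq_sub i hD, h, sub_self]

theorem height_two_mul [NeZero (2 * n)] (i : ZMod (2 * n)) :
    height (P.colorSign i) (2 * n - 1 + 1) = 0 := by
  have := NeZero.pos (2 * n)
  rw [P.height_eq_sub i (by omega), arc_eq_univ, Set.univ_inter, P.card_red,
    ← Set.compl_eq_univ_sdiff, P.card_blue, sub_self]

/-! ### Crossing segments -/

theorem orient_pos [NeZero (2 * n)] (i : ZMod (2 * n)) {a b c : ℕ} (hab : a < b) (hbc : b < c)
    (hc : c < 2 * n) :
    0 < cross (P.v (i + b) - P.v (i + a)) (P.v (i + c) - P.v (i + a)) := by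
  refine P.ccw (i + a) (i + b) (i + c) ?_ ?_
  · intro h
    have := add_natCast_inj (by omega) (by omega) h
    omega
  · rw [add_sub_add_left_eq_sub, add_sub_add_left_eq_sub, val_natCast_sub (by omega) (by omega),
      val_natCast_sub (by omega) (by omega)]
    split_ifs <;> omega

theorem seg_mk (x y : ZMod (2 * n)) : P.seg s(x, y) = segment ℝ (P.v x) (P.v y) := by
  rw [seg, ← convexHull_pair]
  congr 1
  ext z
  simp only [Sym2.mem_iff, Set.mem_image, Set.mem_ofPred_eq, Set.mem_insert_iff,
    Set.mem_singleton_iff]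
  constructor
  · rintro ⟨w, rfl | rfl, rfl⟩ <;> simp
  · rintro (rfl | rfl)
    · exact ⟨x, by simp⟩
    · exact ⟨y, by simp⟩

/-- The intersection point of the diagonals of the quadrilateral `a, c, b, d` is found from the
affine relation between its vertices, whose coefficients are the areas of the four triangles. -/
theorem not_disjoint_of_crossing [NeZero (2 * n)] (i : ZMod (2 * n)) {a b c d : ℕ} (hac : a < c)
    (hcb : c < b) (hbd : b < d) (hd : d < 2 * n) :
    ¬ Disjoint (P.seg s(i + a, i + b)) (P.seg s(i + c, i + d)) := by
  have o1 := P.orient_pos i hcb hbd hd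
  have o2 := P.orient_pos i hac (hcb.trans hbd) hd
  have o3 := P.orient_pos i (hac.trans hcb) hbd hd
  have o4 := P.orient_pos i hac hcb (hbd.trans hd)
  rw [seg_mk, seg_mk, Set.not_disjoint_iff]
  set A := P.v (i + a)
  set B := P.v (i + b)
  set E := P.v (i + c)
  set F := P.v (i + d)
  have hsum : cross (B - E) (F - E) + cross (E - A) (F - A) =
      cross (B - A) (F - A) + cross (E - A) (B - A) := by
    simp only [cross, Complex.sub_re, Complex.sub_im]; ring
  set t := cross (B - E) (F - E) + cross (E - A) (F - A)
  have ht : 0 < t := by positivity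
  refine ⟨(cross (B - E) (F - E) / t) • A + (cross (E - A) (F - A) / t) • B,
    ⟨_, _, by positivity, by positivity, by rw [← add_div]; exact div_self ht.ne', rfl⟩,
    ⟨cross (B - A) (F - A) / t, cross (E - A) (B - A) / t, by positivity, by positivity,
      by rw [← add_div, ← hsum]; exact div_self ht.ne', ?_⟩⟩
  have hlin : cross (B - A) (F - A) • E + cross (E - A) (B - A) • F =
      cross (B - E) (F - E) • A + cross (E - A) (F - A) • B := by
    apply Complex.ext <;>
      simp only [cross, Complex.sub_re, Complex.sub_im, Complex.add_re, Complex.add_im,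
        Complex.real_smul, Complex.re_ofReal_mul, Complex.im_ofReal_mul] <;> ring
  have : t⁻¹ • (cross (B - A) (F - A) • E + cross (E - A) (B - A) • F) =
      t⁻¹ • (cross (B - E) (F - E) • A + cross (E - A) (F - A) • B) := by rw [hlin]
  simpa only [smul_add, smul_smul, div_eq_inv_mul] using this

/-- The segment `E F` lies strictly on one side of the line `A B`. -/
theorem disjoint_segment_of_cross {A B E F : ℂ}
    (h : 0 < cross (B - A) (E - A) * cross (B - A) (F - A)) :
    Disjoint (segment ℝ A B) (segment ℝ E F) := by
  rw [Set.disjoint_left]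
  rintro z ⟨p, q, hp, hq, hpq, rfl⟩ ⟨x, y, hx, hy, hxy, hz⟩
  have h0 : x * cross (B - A) (E - A) + y * cross (B - A) (F - A) = 0 := by
    have e1 : cross (B - A) (x • E + y • F - A) =
        x * cross (B - A) (E - A) + y * cross (B - A) (F - A) := by
      obtain rfl : y = 1 - x := by linarith
      simp only [cross, Complex.sub_re, Complex.sub_im, Complex.add_re, Complex.add_im,
        Complex.real_smul, Complex.re_ofReal_mul, Complex.im_ofReal_mul]
      ring
    rw [← e1, hz]
    obtain rfl : q = 1 - p := by linarith
    simp only [cross, Complex.sub_re, Complex.sub_im, Complex.add_re, Complex.add_im,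
      Complex.real_smul, Complex.re_ofReal_mul, Complex.im_ofReal_mul]
    ring
  rcases pos_and_pos_or_neg_and_neg_of_mul_pos h with ⟨h1, h2⟩ | ⟨h1, h2⟩
  · rcases hx.lt_or_eq with h3 | h3
    · nlinarith [mul_pos h3 h1, mul_nonneg hy h2.le]
    · obtain rfl : y = 1 := by linarith
      rw [← h3] at h0; linarith
  · rcases hx.lt_or_eq with h3 | h3
    · nlinarith [mul_pos h3 (neg_pos.2 h1), mul_nonneg hy (neg_pos.2 h2).le]
    · obtain rfl : y = 1 := by linarith
      rw [← h3] at h0; linarith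

/-- Chords whose end points do not separate each other are disjoint. -/
theorem disjoint_seg [NeZero (2 * n)] (i : ZMod (2 * n)) {a b c d : ℕ} (hab : a < b)
    (hb : b < 2 * n) (hc : c < 2 * n) (hd : d < 2 * n)
    (h : (a < c ∧ c < b ∧ a < d ∧ d < b) ∨ ((c < a ∨ b < c) ∧ (d < a ∨ b < d))) :
    Disjoint (P.seg s(i + a, i + b)) (P.seg s(i + c, i + d)) := by
  rw [seg_mk, seg_mk]
  apply disjoint_segment_of_cross
  have inner : ∀ x, a < x → x < b →
      cross (P.v (i + b) - P.v (i + a)) (P.v (i + x) - P.v (i + a)) < 0 := by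
    intro x hx hx'
    have := P.orient_pos i hx hx' hb
    simp only [cross] at *
    linarith
  have outer : ∀ x < 2 * n, x < a ∨ b < x →
      0 < cross (P.v (i + b) - P.v (i + a)) (P.v (i + x) - P.v (i + a)) := by
    rintro x hx (h | h)
    · have := P.orient_pos i h hab hb
      simp only [cross, Complex.sub_re, Complex.sub_im] at *
      linarith
    · exact P.orient_pos i hab h hx
  rcases h with ⟨h1, h2, h3, h4⟩ | ⟨h1, h2⟩
  · exact mul_pos_of_neg_of_neg (inner c h1 h2) (inner d h3 h4)
  · exact mul_pos (outer c hc h1) (outer d hd h2)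

/-! ### Matchings of points and matchings of positions -/

/-- A matching of the points `i, …, i + D` is given by a matching `f` of the positions
`0, …, D`. -/
theorem IsMatching.exists_isNoncrossing [NeZero (2 * n)] {P : BicoloredPolygon n}
    {i : ZMod (2 * n)} {D : ℕ} (hD : D < 2 * n) {M : Finset (Sym2 (ZMod (2 * n)))}
    (hM : P.IsMatching (arc i (i + D)) M) :
    ∃ f, IsNoncrossing (P.colorSign i) D f ∧
      ∀ a b : ℕ, a ≤ D → b ≤ D →
        (s(i + (a : ZMod (2 * n)), i + (b : ZMod (2 * n))) ∈ M ↔ b = f a) := by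
  have hex : ∀ a : ℕ, ∃ b : ℕ, a ≤ D → b ≤ D ∧
      s(i + (a : ZMod (2 * n)), i + (b : ZMod (2 * n))) ∈ M := by
    intro a
    by_cases ha : a ≤ D
    swap
    · exact ⟨0, fun h => absurd h ha⟩
    obtain ⟨e, ⟨heM, hae⟩, -⟩ := hM.perfect _ (add_mem_arc i hD ha)
    obtain ⟨y, rfl⟩ := hae
    obtain ⟨b, hb, rfl⟩ := exists_of_mem_arc hD (hM.mem_of_mem _ heM y (by simp))
    exact ⟨b, fun _ => ⟨hb, heM⟩⟩
  choose f hf using hex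
  have huniq : ∀ a b c : ℕ, a ≤ D → b ≤ D → c ≤ D →
      s(i + (a : ZMod (2 * n)), i + (b : ZMod (2 * n))) ∈ M →
      s(i + (a : ZMod (2 * n)), i + (c : ZMod (2 * n))) ∈ M → b = c := by
    intro a b c ha hb hc h1 h2
    have := (hM.perfect _ (add_mem_arc i hD ha)).unique ⟨h1, by simp⟩ ⟨h2, by simp⟩
    exact add_natCast_inj (by omega) (by omega) (Sym2.congr_right.1 this)
  have hinv : ∀ a ≤ D, f (f a) = a := by
    intro a ha
    have h1 := hf a ha
    have h2 := hf (f a) h1.1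
    exact huniq (f a) _ _ h1.1 h2.1 ha h2.2 (by rw [Sym2.eq_swap]; exact h1.2)
  refine ⟨f, ⟨fun a ha => (hf a ha).1, hinv, ?_, ?_⟩, ?_⟩
  · intro a ha
    rw [colorSign_eq_neg]
    exact hM.bichromatic _ _ (hf a ha).2
  · intro a b ha hb hab hbf
    have h1 := hf a ha
    have h2 := hf b hb
    have hne : s(i + (a : ZMod (2 * n)), i + (f a : ZMod (2 * n))) ≠
        s(i + (b : ZMod (2 * n)), i + (f b : ZMod (2 * n))) := by
      intro h
      have h3 := h1.2
      have h4 : i + (b : ZMod (2 * n)) ∈ s(i + (a : ZMod (2 * n)), i + (f a : ZMod (2 * n))) := by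
        rw [h]; simp
      rcases Sym2.mem_iff.1 h4 with h5 | h5
      · have := add_natCast_inj (by omega) (by omega) h5; omega
      · have := add_natCast_inj (by omega) (by omega) h5; omega
    have hdis := hM.noncrossing _ h1.2 _ h2.2 hne
    have hfa : f b ≠ a := by
      intro h; have := hinv b hb; rw [h] at this; omega
    have hff : f b ≠ f a := by
      intro h
      have h3 := hinv b hb
      rw [h, hinv a ha] at h3
      omega
    constructor
    · by_contra hcon
      refine P.not_disjoint_of_crossing i (a := f b) (c := a) (b := b) (d := f a) (by omega)
        hab hbf (by omega) ?_
      rw [Sym2.eq_swap (a := i + (f b : ZMod (2 * n)))]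
      exact hdis.symm
    · by_contra hcon
      exact P.not_disjoint_of_crossing i hab hbf (by omega) (by omega) hdis
  · intro a b ha hb
    constructor
    · intro h
      exact huniq a b _ ha hb (hf a ha).1 h (hf a ha).2
    · rintro rfl
      exact (hf a ha).2

/-- The pairs of points that are joined by a matching `g` of the positions `0, …, D`, counted
from `i`. -/
noncomputable def chords (i : ZMod (2 * n)) (D : ℕ) (g : ℕ → ℕ) : Finset (Sym2 (ZMod (2 * n))) :=
  open Classical in (Finset.range (D + 1)).image
    fun a : ℕ => s(i + (a : ZMod (2 * n)), i + (g a : ZMod (2 * n)))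

theorem mem_chords {i : ZMod (2 * n)} {D : ℕ} {g : ℕ → ℕ} {e : Sym2 (ZMod (2 * n))} :
    e ∈ chords i D g ↔ ∃ a ≤ D, e = s(i + (a : ZMod (2 * n)), i + (g a : ZMod (2 * n))) := by
  simp [chords, eq_comm]

theorem exists_lt_of_mem_chords {P : BicoloredPolygon n} {i : ZMod (2 * n)} {D : ℕ} {g : ℕ → ℕ}
    (hg : IsNoncrossing (P.colorSign i) D g) {e : Sym2 (ZMod (2 * n))} (he : e ∈ chords i D g) :
    ∃ a ≤ D, a < g a ∧ e = s(i + (a : ZMod (2 * n)), i + (g a : ZMod (2 * n))) := by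
  obtain ⟨a, ha, rfl⟩ := mem_chords.1 he
  rcases lt_trichotomy a (g a) with h | h | h
  · exact ⟨a, ha, h, rfl⟩
  · exact absurd h.symm (hg.ne (P.isSign_colorSign i) ha)
  · exact ⟨g a, hg.le a ha, by rwa [hg.invol a ha], by rw [hg.invol a ha, Sym2.eq_swap]⟩

theorem isMatching_chords [NeZero (2 * n)] {i : ZMod (2 * n)} {D : ℕ} (hD : D < 2 * n) {g : ℕ → ℕ}
    (hg : IsNoncrossing (P.colorSign i) D g) :
    P.IsMatching (arc i (i + D)) (chords i D g) := by
  refine ⟨?_, ?_, ?_, ?_⟩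
  · intro e he x hx
    obtain ⟨a, ha, rfl⟩ := mem_chords.1 he
    rcases Sym2.mem_iff.1 hx with rfl | rfl
    · exact add_mem_arc i hD ha
    · exact add_mem_arc i hD (hg.le a ha)
  · intro x y hxy
    obtain ⟨a, ha, h⟩ := mem_chords.1 hxy
    have h1 := (P.colorSign_eq_neg).1 (hg.opp a ha)
    rcases Sym2.eq_iff.1 h with ⟨rfl, rfl⟩ | ⟨rfl, rfl⟩
    · exact h1
    · tauto
  · intro x hx
    obtain ⟨a, ha, rfl⟩ := exists_of_mem_arc hD hx
    refine ⟨_, ⟨mem_chords.2 ⟨a, ha, rfl⟩, by simp⟩, ?_⟩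
    rintro e ⟨he, hae⟩
    obtain ⟨b, hb, rfl⟩ := mem_chords.1 he
    have hgb := hg.le b hb
    rcases Sym2.mem_iff.1 hae with h | h
    · rw [add_natCast_inj (by omega) (by omega) h]
    · have h1 := add_natCast_inj (by omega) (by omega) h
      rw [h1, hg.invol b hb, Sym2.eq_swap]
  · intro e he e' he' hne
    obtain ⟨a, ha, hag, rfl⟩ := exists_lt_of_mem_chords hg he
    obtain ⟨c, hc, hcg, rfl⟩ := exists_lt_of_mem_chords hg he'
    have hga := hg.le a ha
    have hgc := hg.le c hc
    have hac : a ≠ c := by rintro rfl; exact hne rfl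
    have h1 : c ≠ g a := by
      rintro rfl
      rw [hg.invol a ha, Sym2.eq_swap] at hne
      exact hne rfl
    have h2 : g c ≠ a := by
      rintro rfl
      rw [hg.invol c hc, Sym2.eq_swap] at hne
      exact hne rfl
    have h3 : g c ≠ g a := fun h => hac (hg.inj ha hc h.symm)
    refine P.disjoint_seg i hag (by omega) (by omega) (by omega) ?_
    rcases lt_or_gt_of_ne hac with h | h
    · rcases lt_or_gt_of_ne h1 with h4 | h4
      · have := hg.nested a c ha hc h h4
        exact Or.inl ⟨h, h4, this.1, this.2⟩
      · exact Or.inr ⟨Or.inr h4, Or.inr (by omega)⟩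
    · rcases lt_or_gt_of_ne h2 with h4 | h4
      · exact Or.inr ⟨Or.inl h, Or.inl h4⟩
      · have := hg.nested c a hc ha h h4
        exact Or.inr ⟨Or.inl h, Or.inr this.2⟩

/-! ### Feasible pairs and orbits -/

/-- The ends of a feasible pair have the same level, as the points between them are balanced. -/
theorem Feasible.level_eq [NeZero (2 * n)] {P : BicoloredPolygon n} {i : ZMod (2 * n)} {d : ℕ}
    (hd : d < 2 * n) (h : P.Feasible i (i + d)) :
    0 < d ∧ level (P.colorSign i) d = level (P.colorSign i) 0 := by
  obtain ⟨M, hM, hiM⟩ := h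
  rw [← arc_eq_univ i] at hM
  have := NeZero.pos (2 * n)
  obtain ⟨f, hf, hfM⟩ := hM.exists_isNoncrossing (by omega)
  have h1 := (hfM 0 d (by omega) (by omega)).1 (by simpa using hiM)
  have h2 := hf.ne (P.isSign_colorSign i) (a := 0) (by omega)
  have h3 := hf.level_eq (P.isSign_colorSign i) (a := 0) (by omega)
  rw [← h1] at h2 h3
  exact ⟨by omega, h3⟩

theorem feasible_of_next [NeZero (2 * n)] (i : ZMod (2 * n)) {d : ℕ} (hd0 : 0 < d) (hd : d < 2 * n)
    (hl : level (P.colorSign i) d = level (P.colorSign i) 0)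
    (hn : ∀ b, 0 < b → b < d → level (P.colorSign i) b ≠ level (P.colorSign i) 0) :
    P.Feasible i (i + d) := by
  obtain ⟨g, hg, h⟩ := exists_tight (P.isSign_colorSign i) (P.height_two_mul i)
  have hs := P.isSign_colorSign i
  have h0 := hg.ne hs (a := 0) (by omega)
  have h1 := hg.level_eq hs (a := 0) (by omega)
  have hgd : g 0 = d := by
    rcases lt_trichotomy (g 0) d with h2 | h2 | h2
    · exact absurd h1 (hn _ (by omega) h2)
    · exact h2
    · exact absurd hl (h 0 (by omega) (by omega) d hd0 h2)
  refine ⟨chords i (2 * n - 1) g, ?_, ?_⟩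
  · rw [← arc_eq_univ i]
    exact P.isMatching_chords (by omega) hg
  · rw [mem_chords]
    exact ⟨0, by omega, by simp [hgd]⟩

theorem o_eq_of_next [NeZero (2 * n)] (i : ZMod (2 * n)) {d : ℕ} (hd0 : 0 < d) (hd : d < 2 * n)
    (hl : level (P.colorSign i) d = level (P.colorSign i) 0)
    (hn : ∀ b, 0 < b → b < d → level (P.colorSign i) b ≠ level (P.colorSign i) 0) :
    P.o i = i + d := by
  have h1 : d ∈ {d : ℕ | P.Feasible i (i + (d : ZMod (2 * n)))} :=
    P.feasible_of_next i hd0 hd hl hn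
  have h2 := Nat.sInf_le h1
  have h3 : P.Feasible i (i + ((sInf {d : ℕ | P.Feasible i (i + (d : ZMod (2 * n)))} : ℕ) :
    ZMod (2 * n))) := Nat.sInf_mem ⟨d, h1⟩
  have h4 := h3.level_eq (by omega)
  rcases h2.lt_or_eq with h5 | h5
  · exact absurd h4.2 (hn _ h4.1 h5)
  · rw [o, h5]

/-- `o` sends a position to the next position of its level. -/
theorem o_add_eq_of_next [NeZero (2 * n)] (i : ZMod (2 * n)) {x y : ℕ} (hxy : x < y)
    (hy : y < 2 * n) (hl : level (P.colorSign i) y = level (P.colorSign i) x)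
    (hn : ∀ b, x < b → b < y → level (P.colorSign i) b ≠ level (P.colorSign i) x) :
    P.o (i + x) = i + y := by
  have h := P.o_eq_of_next (i + x) (d := y - x) (by omega) (by omega)
    (by rw [level_add, level_add, Nat.add_sub_cancel' hxy.le, hl, add_zero])
    (fun b hb hb' h => by
      rw [level_add, level_add, add_zero] at h
      exact hn (x + b) (by omega) (by omega) (by omega))
  rw [h, add_assoc, ← Nat.cast_add, Nat.add_sub_cancel' hxy.le]

/-- Points of the same level are reached from each other by iterating `o`. -/
theorem exists_iterate_o [NeZero (2 * n)] (d : ℕ) : ∀ i : ZMod (2 * n), d < 2 * n →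
    level (P.colorSign i) d = level (P.colorSign i) 0 → ∃ k : ℕ, P.o^[k] i = i + d := by
  induction d using Nat.strong_induction_on with
  | _ d ih =>
    intro i hd hl
    rcases Nat.eq_zero_or_pos d with rfl | hd0
    · exact ⟨0, by simp⟩
    obtain ⟨c, hc0, hcd, hcl, hcn⟩ := exists_first (a := 1) (y := d + 1)
      (p := fun c => level (P.colorSign i) c = level (P.colorSign i) 0) ⟨d, hd0, by omega, hl⟩
    have ho := P.o_eq_of_next i hc0 (by omega) hcl fun b hb hb' => hcn b hb hb'
    obtain ⟨k, hk⟩ := ih (d - c) (by omega) (i + c) (by omega) (by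
      rw [level_add, level_add, Nat.add_sub_cancel' (by omega), hl, add_zero, hcl])
    refine ⟨k + 1, ?_⟩
    rw [Function.iterate_succ_apply, ho, hk, add_assoc, ← Nat.cast_add,
      Nat.add_sub_cancel' (by omega)]

/-- All points of the level of `i` belong to the orbit of `i`. -/
theorem mem_orbit_of_level_eq [NeZero (2 * n)] (i : ZMod (2 * n)) {d : ℕ} (hd : d < 2 * n)
    (hl : level (P.colorSign i) d = level (P.colorSign i) 0) :
    i + (d : ZMod (2 * n)) ∈ P.orbit i := by
  obtain ⟨k, hk⟩ := P.exists_iterate_o d i hd hl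
  exact ⟨k, Or.inl hk⟩

/-- If the next point of the level of `i` is not `i + D`, then it comes before `i + D`. -/
theorem exists_between_of_ne_o [NeZero (2 * n)] (i : ZMod (2 * n)) {D : ℕ} (hD0 : 0 < D)
    (hD : D < 2 * n) (hl : level (P.colorSign i) D = level (P.colorSign i) 0)
    (ho : i + (D : ZMod (2 * n)) ≠ P.o i) :
    ∃ p, 0 < p ∧ p < D ∧ level (P.colorSign i) p = level (P.colorSign i) 0 := by
  by_contra h
  push Not at h
  exact ho (P.o_eq_of_next i hD0 hD hl fun b hb hb' => h b hb hb').symm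

/-! ### Matchings whose diagonals cross a common cut -/

/-- Separation by the chord `(i + p, i + q)` in terms of positions. -/
theorem separates_iff [NeZero (2 * n)] (i : ZMod (2 * n)) {p q x y z w : ℕ} (hpq : p < q)
    (hq : q < 2 * n) (hx : x < 2 * n) (hy : y < 2 * n) (hz : z < 2 * n) (hw : w < 2 * n) :
    Separates s(i + (p : ZMod (2 * n)), i + (q : ZMod (2 * n)))
      s(i + (x : ZMod (2 * n)), i + (y : ZMod (2 * n)))
      s(i + (z : ZMod (2 * n)), i + (w : ZMod (2 * n))) ↔
    ((p ≤ x ∧ x ≤ q ∧ p ≤ y ∧ y ≤ q) ∧ (z ≤ p ∨ q ≤ z) ∧ (w ≤ p ∨ q ≤ w)) ∨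
    (((x ≤ p ∨ q ≤ x) ∧ (y ≤ p ∨ q ≤ y)) ∧ p ≤ z ∧ z ≤ q ∧ p ≤ w ∧ w ≤ q) := by
  have hin := fun c (hc : c < 2 * n) => mem_arc_of_le i hpq.le hq hc
  have hout := fun c (hc : c < 2 * n) => mem_arc_of_lt i hpq hq hc
  constructor
  · rintro ⟨a, b, hab, h1, h2⟩
    have h3 := h1 (i + x) (by simp)
    have h4 := h1 (i + y) (by simp)
    have h5 := h2 (i + z) (by simp)
    have h6 := h2 (i + w) (by simp)
    rcases Sym2.eq_iff.1 hab with ⟨rfl, rfl⟩ | ⟨rfl, rfl⟩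
    · rw [hin x hx] at h3
      rw [hin y hy] at h4
      rw [hout z hz] at h5
      rw [hout w hw] at h6
      omega
    · rw [hout x hx] at h3
      rw [hout y hy] at h4
      rw [hin z hz] at h5
      rw [hin w hw] at h6
      omega
  · rintro (⟨⟨h1, h2, h3, h4⟩, h5, h6⟩ | ⟨⟨h5, h6⟩, h1, h2, h3, h4⟩)
    · refine ⟨i + p, i + q, rfl, fun v hv => ?_, fun v hv => ?_⟩
      · rcases Sym2.mem_iff.1 hv with rfl | rfl
        · exact (hin x hx).2 ⟨h1, h2⟩
        · exact (hin y hy).2 ⟨h3, h4⟩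
      · rcases Sym2.mem_iff.1 hv with rfl | rfl
        · exact (hout z hz).2 h5.symm
        · exact (hout w hw).2 h6.symm
    · refine ⟨i + q, i + p, Sym2.eq_swap, fun v hv => ?_, fun v hv => ?_⟩
      · rcases Sym2.mem_iff.1 hv with rfl | rfl
        · exact (hout x hx).2 h5.symm
        · exact (hout y hy).2 h6.symm
      · rcases Sym2.mem_iff.1 hv with rfl | rfl
        · exact (hin z hz).2 ⟨h1, h2⟩
        · exact (hin w hw).2 ⟨h3, h4⟩

section

variable {P} {i : ZMod (2 * n)} {C D : ℕ} {g : ℕ → ℕ}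

/-- `a` is the left end of a diagonal of the matching `g`. -/
def IsDiagonalStart (P : BicoloredPolygon n) (i : ZMod (2 * n)) (D : ℕ) (g : ℕ → ℕ) (a : ℕ) :
    Prop :=
  a ≤ D ∧ a < g a ∧
    s(i + (a : ZMod (2 * n)), i + (g a : ZMod (2 * n))) ∈ P.diagonals (chords i D g)

theorem mem_diagonals_iff (hg : IsNoncrossing (P.colorSign i) D g) {e : Sym2 (ZMod (2 * n))} :
    e ∈ P.diagonals (chords i D g) ↔
      ∃ a, P.IsDiagonalStart i D g a ∧ e = s(i + (a : ZMod (2 * n)), i + (g a : ZMod (2 * n))) := by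
  constructor
  · intro he
    obtain ⟨a, ha, hag, rfl⟩ := exists_lt_of_mem_chords hg he.1
    exact ⟨a, ⟨ha, hag, he⟩, rfl⟩
  · rintro ⟨a, ha, rfl⟩
    exact ha.2.2

theorem Linked.symm {M : Finset (Sym2 (ZMod (2 * n)))} {e f : Sym2 (ZMod (2 * n))}
    (h : P.Linked M e f) : P.Linked M f e := by
  obtain ⟨h1, k, h2⟩ := h
  exact ⟨h1.symm, k, by rw [h2, Set.pair_comm]⟩

variable [NeZero (2 * n)]

/-- Every diagonal crosses the cut, since a pair of consecutive positions of a level is an edge. -/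
theorem IsDiagonalStart.crosses_cut (hD : D < 2 * n) (hg : IsNoncrossing (P.colorSign i) D g)
    (ht : ∀ a ≤ D, a < g a → (a < C ↔ g a < C) →
      ∀ b, a < b → b < g a → level (P.colorSign i) b ≠ level (P.colorSign i) a)
    {a : ℕ} (ha : P.IsDiagonalStart i D g a) : a < C ∧ C ≤ g a := by
  obtain ⟨haD, hag, -, x, y, hxy, hdiag⟩ := ha
  by_contra hcon
  have hgD := hg.le a haD
  have ho := P.o_add_eq_of_next i hag (by omega) (hg.level_eq (P.isSign_colorSign i) haD)
    (ht a haD hag (by omega))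
  refine hdiag.2 ⟨hdiag.1, ?_⟩
  rcases Sym2.eq_iff.1 hxy with ⟨rfl, rfl⟩ | ⟨rfl, rfl⟩
  · exact Or.inr ho.symm
  · exact Or.inl ho.symm

theorem diagonal_injective (hD : D < 2 * n) (hg : IsNoncrossing (P.colorSign i) D g) {a b : ℕ}
    (ha : P.IsDiagonalStart i D g a) (hb : P.IsDiagonalStart i D g b)
    (h : s(i + (a : ZMod (2 * n)), i + (g a : ZMod (2 * n))) =
      s(i + (b : ZMod (2 * n)), i + (g b : ZMod (2 * n)))) : a = b := by
  have h1 := ha.1; have h2 := ha.2.1; have h3 := hg.le a ha.1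
  have h4 := hb.1; have h5 := hb.2.1; have h6 := hg.le b hb.1
  rcases Sym2.eq_iff.1 h with ⟨h7, -⟩ | ⟨h7, h8⟩
  · exact add_natCast_inj (by omega) (by omega) h7
  · have := add_natCast_inj (by omega) (by omega) h7
    have := add_natCast_inj (by omega) (by omega) h8
    omega

/-- Diagonals that are consecutive in the nested family of all diagonals bound the region at the
side of the polygon that follows the left end of the outer one. -/
theorem linked_of_consecutive (hD : D < 2 * n) (hg : IsNoncrossing (P.colorSign i) D g)
    (hcut : ∀ a, P.IsDiagonalStart i D g a → a < C ∧ C ≤ g a) {a b : ℕ}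
    (ha : P.IsDiagonalStart i D g a) (hb : P.IsDiagonalStart i D g b) (hab : a < b)
    (hbetween : ∀ c, a < c → c < b → ¬ P.IsDiagonalStart i D g c) :
    P.Linked (chords i D g) s(i + (a : ZMod (2 * n)), i + (g a : ZMod (2 * n)))
      s(i + (b : ZMod (2 * n)), i + (g b : ZMod (2 * n))) := by
  have hnest : ∀ c d, P.IsDiagonalStart i D g c → P.IsDiagonalStart i D g d → c < d →
      g d < g c := by
    intro c d hc hd hcd
    have h1 := hcut c hc
    have h2 := hcut d hd
    exact (hg.nested c d hc.1 hd.1 hcd (by omega)).2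
  have hle : ∀ c, P.IsDiagonalStart i D g c → g c < 2 * n := fun c hc => by
    have := hg.le c hc.1; omega
  have hab' := hnest a b ha hb hab
  have hga := hle a ha
  have hgb := hle b hb
  have hbg := hb.2.1
  have hside : s(i + (a : ZMod (2 * n)), i + (a : ZMod (2 * n)) + 1) =
      s(i + (a : ZMod (2 * n)), i + ((a + 1 : ℕ) : ZMod (2 * n))) := by
    rw [Nat.cast_add, Nat.cast_one, add_assoc]
  refine ⟨fun h => hab.ne (diagonal_injective hD hg ha hb h), i + a, ?_⟩
  rw [hside]
  have hne : ∀ c, P.IsDiagonalStart i D g c →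
      s(i + (c : ZMod (2 * n)), i + (g c : ZMod (2 * n))) ≠
      s(i + (a : ZMod (2 * n)), i + ((a + 1 : ℕ) : ZMod (2 * n))) := by
    intro c hc h
    have h1 := hc.2.1
    have h2 := hle c hc
    rcases Sym2.eq_iff.1 h with ⟨h3, h4⟩ | ⟨h3, h4⟩
    · have h5 := add_natCast_inj (by omega) (by omega) h3
      have h6 := add_natCast_inj (by omega) (by omega) h4
      rw [h5] at h6
      omega
    · have h5 := add_natCast_inj (by omega) (by omega) h3
      have h6 := add_natCast_inj (by omega) (by omega) h4
      omega
  ext e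
  simp only [bounding, Set.mem_ofPred_eq, Set.mem_insert_iff, Set.mem_singleton_iff]
  constructor
  · rintro ⟨he, hsep⟩
    obtain ⟨c, hc, rfl⟩ := (mem_diagonals_iff hg).1 he
    have hgc := hle c hc
    have hcg := hc.2.1
    rcases lt_trichotomy c a with h | h | h
    · refine absurd ?_ (hsep _ ha.2.2 (fun h' => h.ne (diagonal_injective hD hg hc ha h'.symm))
        (hne a ha))
      have := hnest c a hc ha h
      rw [separates_iff i ha.2.1 hga (by omega) (by omega) (by omega) (by omega)]
      omega
    · rw [h]; exact Or.inl rfl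
    · rcases lt_trichotomy c b with h' | h' | h'
      · exact absurd hc (hbetween c h h')
      · rw [h']; exact Or.inr rfl
      · refine absurd ?_ (hsep _ hb.2.2 (fun h'' => h'.ne (diagonal_injective hD hg hb hc h''))
          (hne b hb))
        have := hnest b c hb hc h'
        rw [separates_iff i hb.2.1 hgb (by omega) (by omega) (by omega) (by omega)]
        omega
  · have key : ∀ d, (d = a ∨ d = b) → P.IsDiagonalStart i D g d → ∀ f ∈ P.diagonals (chords i D g),
        f ≠ s(i + (d : ZMod (2 * n)), i + (g d : ZMod (2 * n))) →
        ¬ Separates f s(i + (d : ZMod (2 * n)), i + (g d : ZMod (2 * n)))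
          s(i + (a : ZMod (2 * n)), i + ((a + 1 : ℕ) : ZMod (2 * n))) := by
      intro d hdab hd f hf hfd
      obtain ⟨c, hc, rfl⟩ := (mem_diagonals_iff hg).1 hf
      have hcd : c ≠ d := by rintro rfl; exact hfd rfl
      have hgc := hle c hc
      have hgd := hle d hd
      have hcg := hc.2.1
      have hdg := hd.2.1
      have h1 : c ≤ a ∨ b ≤ c := by
        by_contra h
        exact hbetween c (by omega) (by omega) hc
      have h2 : c < a → g a < g c := hnest c a hc ha
      have h3 : b < c → g c < g b := hnest b c hb hc
      have h4 : c = a → g c = g a := fun h => by rw [h]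
      have h5 : c = b → g c = g b := fun h => by rw [h]
      have h6 : d = a → g d = g a := fun h => by rw [h]
      have h7 : d = b → g d = g b := fun h => by rw [h]
      rw [separates_iff i hcg hgc (by omega) (by omega) (by omega) (by omega)]
      omega
    rintro (rfl | rfl)
    · exact ⟨ha.2.2, fun f hf hne _ => key a (Or.inl rfl) ha f hf hne⟩
    · exact ⟨hb.2.2, fun f hf hne _ => key b (Or.inr rfl) hb f hf hne⟩

theorem reflTransGen_linked (hD : D < 2 * n) (hg : IsNoncrossing (P.colorSign i) D g)
    (hcut : ∀ a, P.IsDiagonalStart i D g a → a < C ∧ C ≤ g a) (m : ℕ) : ∀ a b : ℕ, b - a = m →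
    P.IsDiagonalStart i D g a → P.IsDiagonalStart i D g b → a ≤ b →
    Relation.ReflTransGen (P.Linked (chords i D g))
      s(i + (a : ZMod (2 * n)), i + (g a : ZMod (2 * n)))
      s(i + (b : ZMod (2 * n)), i + (g b : ZMod (2 * n))) := by
  induction m using Nat.strong_induction_on with
  | _ m ih =>
    intro a b hm ha hb hab
    rcases hab.lt_or_eq with h | rfl
    · obtain ⟨c, hc1, hc2, hc3, hc4⟩ := exists_first (p := P.IsDiagonalStart i D g) (a := a + 1)
        (y := b + 1) ⟨b, h, by omega, hb⟩
      exact (ih (b - c) (by omega) c b rfl hc3 hb (by omega)).head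
        (linked_of_consecutive hD hg hcut ha hc3 (by omega) hc4)
    · exact Relation.ReflTransGen.refl

/-- If only pairs across the cut `C` are diagonals, then the diagonals are nested. So they form one
cascade, and the outermost one is the only one that bounds the region at `(i, i + D)`. -/
theorem admissible_chords (hD : D < 2 * n) (hg : IsNoncrossing (P.colorSign i) D g)
    (hne : g 0 ≠ D)
    (ht : ∀ a ≤ D, a < g a → (a < C ↔ g a < C) →
      ∀ b, a < b → b < g a → level (P.colorSign i) b ≠ level (P.colorSign i) a) :
    P.Admissible i (i + D) (chords i D g) := by
  have hcut : ∀ a, P.IsDiagonalStart i D g a → a < C ∧ C ≤ g a :=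
    fun a ha => ha.crosses_cut hD hg ht
  have hconn : ∀ e ∈ P.diagonals (chords i D g), ∀ f ∈ P.diagonals (chords i D g),
      Relation.ReflTransGen (P.Linked (chords i D g)) e f := by
    intro e he f hf
    obtain ⟨a, ha, rfl⟩ := (mem_diagonals_iff hg).1 he
    obtain ⟨b, hb, rfl⟩ := (mem_diagonals_iff hg).1 hf
    rcases le_total a b with h | h
    · exact reflTransGen_linked hD hg hcut _ a b rfl ha hb h
    · have := reflTransGen_linked hD hg hcut _ b a rfl hb ha h
      rw [← Relation.reflTransGen_swap]
      exact Relation.ReflTransGen.mono (fun _ _ h => Linked.symm h) _ _ this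
  refine ⟨P.isMatching_chords hD hg, ?_, ?_⟩
  · rintro A ⟨e, he, rfl⟩ B ⟨f, hf, rfl⟩
    ext d
    exact ⟨(hconn f hf e he).trans, (hconn e he f hf).trans⟩
  · rintro e ⟨⟨he, hesep⟩, -⟩ f ⟨⟨hf, hfsep⟩, -⟩
    obtain ⟨a, ha, rfl⟩ := (mem_diagonals_iff hg).1 he
    obtain ⟨b, hb, rfl⟩ := (mem_diagonals_iff hg).1 hf
    have h0 : s(i, i + (D : ZMod (2 * n))) =
        s(i + ((0 : ℕ) : ZMod (2 * n)), i + (D : ZMod (2 * n))) := by simp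
    rw [h0] at hesep hfsep
    have hne' : ∀ a, P.IsDiagonalStart i D g a →
        s(i + (a : ZMod (2 * n)), i + (g a : ZMod (2 * n))) ≠
        s(i + ((0 : ℕ) : ZMod (2 * n)), i + (D : ZMod (2 * n))) := by
      intro a ha h
      have h1 := ha.2.1
      have h2 := hg.le a ha.1
      rcases Sym2.eq_iff.1 h with ⟨h3, h4⟩ | ⟨h3, h4⟩
      · have h5 := add_natCast_inj (by omega) (by omega) h3
        have h6 := add_natCast_inj (by omega) (by omega) h4
        rw [h5] at h6
        exact hne h6
      · have h5 := add_natCast_inj (by omega) (by omega) h3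
        have h6 := add_natCast_inj (by omega) (by omega) h4
        omega
    have key : ∀ a b, P.IsDiagonalStart i D g a → P.IsDiagonalStart i D g b → a < b →
        Separates s(i + (a : ZMod (2 * n)), i + (g a : ZMod (2 * n)))
          s(i + (b : ZMod (2 * n)), i + (g b : ZMod (2 * n)))
          s(i + ((0 : ℕ) : ZMod (2 * n)), i + (D : ZMod (2 * n))) := by
      intro a b ha hb hab
      have h1 := hcut a ha
      have h2 := hcut b hb
      have h3 := hg.nested a b ha.1 hb.1 hab (by omega)
      have h4 := hg.le a ha.1
      have h5 := hb.2.1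
      rw [separates_iff i ha.2.1 (by omega) (by omega) (by omega) (by omega) (by omega)]
      omega
    rcases lt_trichotomy a b with h | h | h
    · exact absurd (key a b ha hb h) (hfsep _ ha.2.2
        (fun h' => h.ne (diagonal_injective hD hg ha hb h')) (hne' a ha))
    · rw [h]
    · exact absurd (key b a hb ha h) (hesep _ hb.2.2
        (fun h' => h.ne (diagonal_injective hD hg hb ha h')) (hne' b hb))

end

/-! ### Candidate pairs -/

open Real

/-- The points in the order in which they are met from `i` in the positive direction. -/
def vertex (i : ZMod (2 * n)) (a : ℕ) : ℂ := P.v (i + a)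

/-- The points `i, …, i + D` form a chain of turning angle at most `2π/3` whose ends, and some point
between them, have the same level. -/
structure IsLongChain (i : ZMod (2 * n)) (D : ℕ) : Prop where
  chain : ConvexChain (P.vertex i) D
  lt : D < 2 * n
  level_eq : level (P.colorSign i) D = level (P.colorSign i) 0
  between : ∃ p, 0 < p ∧ p < D ∧ level (P.colorSign i) p = level (P.colorSign i) 0

/-- At `i`, all points of the level of `i` between `i` and `i + D` are seen at an angle of at least
`π/3` from `i + D`. -/
def IsWideLeft (i : ZMod (2 * n)) (D : ℕ) : Prop :=
  P.IsLongChain i D ∧ ∀ p, 0 < p → p < D → level (P.colorSign i) p = level (P.colorSign i) 0 →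
    π / 3 ≤ dir (P.vertex i) 0 D - dir (P.vertex i) 0 p

/-- At `i + D`, all points of the level of `i` between `i` and `i + D` are seen at an angle of at
least `π/3` from `i`. -/
def IsWideRight (i : ZMod (2 * n)) (D : ℕ) : Prop :=
  P.IsLongChain i D ∧ ∀ p, 0 < p → p < D → level (P.colorSign i) p = level (P.colorSign i) 0 →
    π / 3 ≤ dir (P.vertex i) p D - dir (P.vertex i) 0 D

/-- For an angle in `(-π, π]`, reducing it to `[0, 2π)` either changes nothing or gives a value
above `π`. -/
theorem nonneg_and_le_of_toIcoMod_le {x : ℝ} (h1 : -π < x) (h2 : x ≤ π)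
    (h : toIcoMod Real.two_pi_pos 0 x ≤ 2 * π / 3) : 0 ≤ x ∧ x ≤ 2 * π / 3 := by
  have hpi := Real.pi_pos
  rcases le_or_gt 0 x with h3 | h3
  · rw [(toIcoMod_eq_self Real.two_pi_pos).2 ⟨h3, by linarith⟩] at h
    exact ⟨h3, h⟩
  · rw [← toIcoMod_add_right, (toIcoMod_eq_self Real.two_pi_pos).2 ⟨by linarith, by linarith⟩] at h
    linarith

section

variable {P} {i : ZMod (2 * n)} {D : ℕ}

/-- The value of a matching whose chords are not longer than all chords of another one. -/
theorem bn_chords_le {f g : ℕ → ℕ} (hg : IsNoncrossing (P.colorSign i) D g)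
    {M : Finset (Sym2 (ZMod (2 * n)))}
    (hfM : ∀ a b : ℕ, a ≤ D → b ≤ D →
      (s(i + (a : ZMod (2 * n)), i + (b : ZMod (2 * n))) ∈ M ↔ b = f a))
    (hf : IsNoncrossing (P.colorSign i) D f)
    (h : ∀ a ≤ D, a < g a → ∃ b ≤ D, dist (P.vertex i a) (P.vertex i (g a)) ≤
      dist (P.vertex i b) (P.vertex i (f b))) : P.bn (chords i D g) ≤ P.bn M := by
  refine Finset.sup_le fun e he => ?_
  obtain ⟨a, ha, hag, rfl⟩ := exists_lt_of_mem_chords hg he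
  obtain ⟨b, hb, hab⟩ := h a ha hag
  refine le_trans ?_ (Finset.le_sup ((hfM b (f b) hb (hf.le b hb)).2 rfl))
  rw [← NNReal.coe_le_coe]
  exact hab

/-- The angles at the common left end of two chains would add up to at least `2π/3`. -/
theorem IsWideLeft.not_lt {D' : ℕ} (h : P.IsWideLeft i D) (h' : P.IsWideLeft i D') : ¬ D < D' := by
  intro hlt
  obtain ⟨p, hp0, hpD, hpl⟩ := h.1.between
  have e1 := h.2 p hp0 hpD hpl
  have e2 := h'.2 D (by omega) hlt h.1.level_eq
  have hV := h'.1.chain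
  have e3 := hV.dir_nonneg hp0 (by omega)
  have e4 := hV.dir_lt_right hp0 (hpD.trans hlt) le_rfl
  have e5 := hV.dir_le (hpD.trans hlt) le_rfl
  linarith

/-- Directions in a part of a chain differ from those in the chain by a constant. -/
theorem dir_vertex_add (hV : ConvexChain (P.vertex i) D) {x a b : ℕ} (hab : a < b)
    (hb : x + b ≤ D) :
    dir (P.vertex (i + x)) a b =
      dir (P.vertex i) (x + a) (x + b) - dir (P.vertex i) x (x + 1) := by
  have hv : ∀ c : ℕ, P.vertex (i + x) c = P.vertex i (x + c) := by
    intro c; simp [vertex, add_assoc]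
  have e1 := hV.dir_nonneg (a := x + a) (b := x + b) (by omega) hb
  have e2 := hV.dir_le (a := x + a) (b := x + b) (by omega) hb
  have e3 := hV.dir_nonneg (a := x) (b := x + 1) (by omega) (by omega)
  have e4 := hV.dir_le (a := x) (b := x + 1) (by omega) (by omega)
  have n1 := hV.div_ne (a := x + a) (b := x + b) (by omega) hb
  have n2 := hV.div_ne (a := x) (b := x + 1) (by omega) (by omega)
  have hpi := Real.pi_pos
  unfold dir at *
  rw [hv, hv, hv, hv, add_zero, ← div_div_div_cancel_right₀ hV.first_ne]
  have h1 := (Complex.arg_div_coe_angle n1 n2)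
  rw [← Real.Angle.coe_sub] at h1
  have h2 := congrArg Real.Angle.toReal h1
  rwa [Complex.arg_coe_angle_toReal_eq_arg, Real.Angle.toReal_coe_eq_self_iff.2
    ⟨by linarith, by linarith⟩] at h2

/-- The angles at the common right end of two chains would add up to at least `2π/3`. -/
theorem IsWideRight.false_of_inner {x : ℕ} (hx : 0 < x) (hxD : x < D) (h : P.IsWideRight i D)
    (h' : P.IsWideRight (i + x) (D - x)) : False := by
  obtain ⟨p, hp0, hpD, hpl⟩ := h'.1.between
  have e1 := h'.2 p hp0 hpD hpl
  have hV := h.1.chain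
  rw [dir_vertex_add hV hpD (by omega), dir_vertex_add hV (by omega) (by omega),
    Nat.add_sub_cancel' hxD.le, add_zero] at e1
  have hl := h'.1.level_eq
  rw [level_add, level_add, Nat.add_sub_cancel' hxD.le, h.1.level_eq, add_zero] at hl
  have e2 := h.2 x hx hxD (by omega)
  have e3 := hV.dir_nonneg hx hxD.le
  have e4 := hV.dir_lt_left hx hxD le_rfl
  have e5 := hV.dir_le (a := x + p) (b := D) (by omega) le_rfl
  linarith

variable [NeZero (2 * n)]

theorem convexChain_vertex (hD3 : 3 ≤ D) (hD : D < 2 * n)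
    (h : P.turningAngle i (i + D) ≤ 2 * π / 3) : ConvexChain (P.vertex i) D := by
  have h1 : i + (D : ZMod (2 * n)) - 1 = i + ((D - 1 : ℕ) : ZMod (2 * n)) := by
    rw [Nat.cast_sub (by omega), Nat.cast_one, add_sub_assoc]
  have h2 := nonneg_and_le_of_toIcoMod_le (Complex.neg_pi_lt_arg _) (Complex.arg_le_pi _) h
  refine ⟨hD3, fun a b c hab hbc hc => P.orient_pos i hab hbc (by omega), ?_, ?_⟩ <;>
  · simp only [vertex, Nat.cast_one, Nat.cast_zero, add_zero]
    rw [← h1]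
    tauto

theorem pos_of_balanced (hD : D < 2 * n) (h : P.Balanced (arc i (i + D))) : 0 < D := by
  have h1 := P.height_eq_zero_of_balanced hD h
  by_contra h2
  obtain rfl : D = 0 := by omega
  rw [height_succ, height_zero] at h1
  rcases P.isSign_colorSign i 0 with h3 | h3 <;> omega

/-- A solution exists, since the matching by pairs of consecutive positions of the levels is
admissible. -/
theorem exists_isSolution (hD : D < 2 * n) (hb : P.Balanced (arc i (i + D)))
    (ho : i + (D : ZMod (2 * n)) ≠ P.o i) : ∃ M, P.IsSolution i (i + D) M := by
  have hs := P.isSign_colorSign i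
  have hD0 := pos_of_balanced hD hb
  obtain ⟨g, hg, ht⟩ := exists_tight hs (P.height_eq_zero_of_balanced hD hb)
  have hne : g 0 ≠ D := by
    intro h
    refine ho (P.o_eq_of_next i hD0 hD ?_ fun b h1 h2 => ?_).symm
    · rw [← h]; exact hg.level_eq hs (by omega)
    · exact ht 0 (by omega) (by omega) b h1 (by omega)
  have hadm := admissible_chords (C := D + 1) hD hg hne fun a ha hag _ => ht a ha hag
  obtain ⟨M, hM, hmin⟩ := Set.exists_min_image {M | P.Admissible i (i + D) M} P.bn
    (Set.toFinite _) ⟨_, hadm⟩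
  exact ⟨M, hM, hmin⟩

/-- A candidate pair that is not of the form `(i, o i)` has the angle property at one of its
ends. -/
theorem IsCandidate.isWide (hD : D < 2 * n) (h : P.IsCandidate i (i + D))
    (ho : i + (D : ZMod (2 * n)) ≠ P.o i) :
    P.IsLongChain i D ∧ (P.IsWideLeft i D ∨ P.IsWideRight i D) := by
  obtain ⟨⟨hb, hnec⟩, hturn⟩ := h
  have hs := P.isSign_colorSign i
  have hD0 := pos_of_balanced hD hb
  obtain ⟨M, hM⟩ := exists_isSolution hD hb ho
  obtain ⟨f, hf, hfM⟩ := hM.1.isMatching.exists_isNoncrossing hD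
  have hf0 : f 0 = D := ((hfM 0 D (by omega) le_rfl).1 (by simpa using hnec M hM)).symm
  have hlev : level (P.colorSign i) D = level (P.colorSign i) 0 := by
    rw [← hf0]; exact hf.level_eq hs (by omega)
  have hbet := P.exists_between_of_ne_o i hD0 hD hlev ho
  have hD3 : 3 ≤ D := by
    obtain ⟨p, hp0, hpD, -⟩ := hbet
    by_contra hcon
    -- the number of points of a balanced set is even
    obtain rfl : D = 2 := by omega
    have h1 := P.height_eq_zero_of_balanced hD hb
    rw [height_succ, height_succ, height_succ, height_zero] at h1
    rcases hs 0 with h2 | h2 <;> rcases hs 1 with h3 | h3 <;> rcases hs 2 with h4 | h4 <;> omega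
  have hV := convexChain_vertex hD3 hD hturn
  have hlong : P.IsLongChain i D := ⟨hV, hD, hlev, hbet⟩
  refine ⟨hlong, ?_⟩
  rcases hV.exists_isRematching hs hf hf0 hbet with ⟨C, g, hg⟩ | h | h
  · exfalso
    have hadm := admissible_chords hD hg.isNoncrossing hg.ne hg.tight
    have hle := bn_chords_le hg.isNoncrossing hfM hf hg.short
    have hmem := hnec _ ⟨hadm, fun M' hM' => hle.trans (hM.2 M' hM')⟩
    obtain ⟨g', hg', hgM'⟩ := hadm.isMatching.exists_isNoncrossing hD
    have h1 := (hgM' 0 D (by omega) le_rfl).1 (by simpa using hmem)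
    have h2 := (hgM' 0 (g 0) (by omega) (hg.isNoncrossing.le 0 (by omega))).1
      (mem_chords.2 ⟨0, by omega, rfl⟩)
    exact hg.ne (h2.trans h1.symm)
  · exact Or.inl ⟨hlong, fun p h1 h2 h3 => (h p h1 h2 h3).le⟩
  · exact Or.inr ⟨hlong, fun p h1 h2 h3 => (h p h1 h2 h3).le⟩

end

/-- The number of steps from `i` to `j` in the positive direction. -/
def steps (i j : ZMod (2 * n)) : ℕ := (j - i).val

section

variable {P} [NeZero (2 * n)] {i j k : ZMod (2 * n)}

theorem steps_lt (i j : ZMod (2 * n)) : steps i j < 2 * n := ZMod.val_lt _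

theorem add_steps (i j : ZMod (2 * n)) : i + (steps i j : ZMod (2 * n)) = j := by
  rw [steps, ZMod.natCast_zmod_val]; ring

theorem IsWideLeft.right_unique (h : P.IsWideLeft i (steps i j)) (h' : P.IsWideLeft i (steps i k)) :
    j = k := by
  have := h.not_lt h'
  have := h'.not_lt h
  rw [← add_steps i j, ← add_steps i k, show steps i j = steps i k by omega]

theorem steps_eq_sub (h0 : 0 < steps j k) (h : steps j k < steps i k) :
    steps j k = steps i k - steps i j ∧ steps i j < steps i k ∧ 0 < steps i j := by
  have h1 := val_natCast_sub (n := n) (steps_lt i j) (steps_lt i k)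
  have h2 : ((steps i k : ℕ) : ZMod (2 * n)) - (steps i j : ℕ) = k - j := by
    simp only [steps, ZMod.natCast_zmod_val]; ring
  rw [h2] at h1
  change steps j k = _ at h1
  have h3 := steps_lt i j
  split_ifs at h1 <;> omega

theorem IsWideRight.left_unique (h : P.IsWideRight i (steps i k))
    (h' : P.IsWideRight j (steps j k)) : i = j := by
  have key : ∀ {i j : ZMod (2 * n)}, P.IsWideRight i (steps i k) → P.IsWideRight j (steps j k) →
      ¬ steps j k < steps i k := by
    intro i j h h' hlt
    obtain ⟨p, -, hp, -⟩ := h'.1.between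
    obtain ⟨h1, h2, h3⟩ := steps_eq_sub (by omega) hlt
    refine IsWideRight.false_of_inner h3 h2 h ?_
    rwa [add_steps, ← h1]
  have h1 := key h h'
  have h2 := key h' h
  have h3 : steps i k = steps j k := by omega
  have h4 := add_steps i k
  rw [h3] at h4
  exact add_right_cancel (h4.trans (add_steps j k).symm)

theorem IsCandidateDiagonal.isLongChain (h : P.IsCandidateDiagonal i j) :
    P.IsLongChain i (steps i j) := by
  refine (IsCandidate.isWide (steps_lt i j) (by rw [add_steps]; exact h.1) fun ho => ?_).1
  rw [add_steps] at ho
  exact h.2.2 ⟨h.2.1, Or.inr ho⟩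

/-- The points on the level of `i` inside the chain belong to the region of the polarity. -/
theorem HasPolarity.mem_region {s : Polarity} (h : P.HasPolarity s i j) {p : ℕ} (hp0 : 0 < p)
    (hp : p < steps i j) (hl : level (P.colorSign i) p = level (P.colorSign i) 0) :
    P.vertex i p ∈ s.region (P.v i) (P.v j) := by
  have hD := steps_lt i j
  refine h.2 _ ⟨?_, P.mem_orbit_of_level_eq i (by omega) hl⟩ ?_ ?_
  · have := add_mem_arc i hD hp.le
    rwa [add_steps] at this
  · intro h0
    have := add_natCast_inj (i := i) (a := p) (b := 0) (by omega) (by omega)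
      (by rw [h0, Nat.cast_zero, add_zero])
    omega
  · intro h0
    have := add_natCast_inj (i := i) (a := p) (b := steps i j) (by omega) hD
      (by rw [h0, add_steps])
    omega

theorem HasPolarity.isWideLeft (h : P.HasPolarity .neg i j) : P.IsWideLeft i (steps i j) := by
  have hl := h.1.isLongChain
  refine ⟨hl, fun p hp0 hp hlev => ?_⟩
  by_contra hcon
  have h1 := hl.chain.dist_lt_of_left hp0 hp le_rfl (not_le.1 hcon)
  have h2 : dist (P.v i) (P.v j) ≤ dist (P.vertex i p) (P.v j) := (h.mem_region hp0 hp hlev).2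
  simp only [vertex, add_steps, Nat.cast_zero, add_zero] at h1 h2
  linarith

theorem HasPolarity.isWideRight (h : P.HasPolarity .pos i j) : P.IsWideRight i (steps i j) := by
  have hl := h.1.isLongChain
  refine ⟨hl, fun p hp0 hp hlev => ?_⟩
  by_contra hcon
  have h1 := hl.chain.dist_lt_of_right hp0 hp le_rfl (not_le.1 hcon)
  have h2 : dist (P.v i) (P.v j) ≤ dist (P.vertex i p) (P.v i) := (h.mem_region hp0 hp hlev).2
  simp only [vertex, add_steps, Nat.cast_zero, add_zero] at h1 h2
  rw [dist_comm (P.v (i + p))] at h2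
  linarith

theorem ncard_isCandidate_le :
    {p : ZMod (2 * n) × ZMod (2 * n) | P.IsCandidate p.1 p.2}.ncard ≤ 3 * (2 * n) := by
  have hcard : (Set.univ : Set (ZMod (2 * n))).ncard = 2 * n := by
    rw [Set.ncard_univ, Nat.card_zmod]
  set A : Set (ZMod (2 * n) × ZMod (2 * n)) := {p | p.2 = P.o p.1}
  set B : Set (ZMod (2 * n) × ZMod (2 * n)) := {p | P.IsWideLeft p.1 (steps p.1 p.2)}
  set E : Set (ZMod (2 * n) × ZMod (2 * n)) := {p | P.IsWideRight p.1 (steps p.1 p.2)}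
  have hsub : {p : ZMod (2 * n) × ZMod (2 * n) | P.IsCandidate p.1 p.2} ⊆ A ∪ B ∪ E := by
    rintro ⟨i, j⟩ hp
    by_cases ho : j = P.o i
    · exact Or.inl (Or.inl ho)
    · rcases (IsCandidate.isWide (P := P) (steps_lt i j) (by rw [add_steps]; exact hp)
        (by rw [add_steps]; exact ho)).2 with h | h
      · exact Or.inl (Or.inr h)
      · exact Or.inr h
  have hA : A.ncard ≤ 2 * n := by
    refine (Set.ncard_le_ncard_of_injOn Prod.fst (fun _ _ => Set.mem_univ _) ?_).trans_eq hcard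
    rintro ⟨i, j⟩ h ⟨i', j'⟩ h' (rfl : i = i')
    have h1 : j = P.o i := h
    have h2 : j' = P.o i := h'
    rw [h1, h2]
  have hB : B.ncard ≤ 2 * n := by
    refine (Set.ncard_le_ncard_of_injOn Prod.fst (fun _ _ => Set.mem_univ _) ?_).trans_eq hcard
    rintro ⟨i, j⟩ h ⟨i', j'⟩ h' (rfl : i = i')
    exact Prod.ext rfl (IsWideLeft.right_unique (P := P) h h')
  have hE : E.ncard ≤ 2 * n := by
    refine (Set.ncard_le_ncard_of_injOn Prod.snd (fun _ _ => Set.mem_univ _) ?_).trans_eq hcard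
    rintro ⟨i, j⟩ h ⟨i', j'⟩ h' (rfl : j = j')
    exact Prod.ext (IsWideRight.left_unique (P := P) h h') rfl
  have h1 := Set.ncard_le_ncard hsub (Set.toFinite _)
  have h2 := Set.ncard_union_le (A ∪ B) E
  have h3 := Set.ncard_union_le A B
  omega

end

end BicoloredPolygon

theorem mainTheorem4 (n : ℕ) (hn : 1 ≤ n) (P : BicoloredPolygon n) :
    (∀ (s : BicoloredPolygon.Polarity) (i j k l : ZMod (2 * n)),
      P.HasPolarity s i j → P.HasPolarity s k l → s.pole i j = s.pole k l → i = k ∧ j = l) ∧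
    {p : ZMod (2 * n) × ZMod (2 * n) | P.IsCandidate p.1 p.2}.ncard ≤ 3 * (2 * n) := by
  have : NeZero (2 * n) := ⟨by omega⟩
  refine ⟨fun s i j k l h h' hp => ?_, BicoloredPolygon.ncard_isCandidate_le⟩
  cases s with
  | neg =>
    obtain rfl : i = k := hp
    exact ⟨rfl, h.isWideLeft.right_unique h'.isWideLeft⟩
  | pos =>
    obtain rfl : j = l := hp
    exact ⟨h.isWideRight.left_unique h'.isWideRight, rfl⟩
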